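/- Let $R$ be a commutative ring with unit element whose characteristic $\ell = \operatorname{char} R$ is either an odd natural number or $0$. Let $G_R$ be the Grassmann algebra over $R$, i.e. the associative $R$-algebra with unit generated by $e_i$, $i \in \mathbb N$, with the relations $e_i e_j = -e_j e_i$, $i, j \in \mathbb N$. Let $\mathbb Z\langle X\rangle$ be the free associative ring without unit on $X=\{x_1,x_2,\dots\}$, let $\mathrm{Id}(G_R,\mathbb Z)$ be the set of polynomial identities of $G_R$ with integer coefficients, i.e. of all $f \in \mathbb Z\langle X\rangle$ with $\psi(f)=0$ for every ring homomorphism $\psi\colon \mathbb Z\langle X\rangle\to G_R$, and for $n\geq 1$ let $P_n(\mathbb Z)\subset \mathbb Z\langle X\rangle$ be the additive subgroup generated by the monomials $x_{\sigma(1)}x_{\sigma(2)}\cdots x_{\sigma(n)}$, $\sigma\in S_n$. The symmetric group $S_n$ acts on $P_n(\mathbb Z)$ and on $P_n(\mathbb Z)/(P_n(\mathbb Z)\cap \mathrm{Id}(G_R,\mathbb Z))$ by permuting the variables $x_1,\dots,x_n$. For a partition $\lambda\vdash n$ and a Young tableau $T_\lambda$ of shape $\lambda$, with row stabilizer $R_{T_\lambda}$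 and column stabilizer $C_{T_\lambda}$, let $a_{T_\lambda}=\sum_{\pi\in R_{T_\lambda}}\pi$, $b_{T_\lambda}=\sum_{\sigma\in C_{T_\lambda}}(\operatorname{sign}\sigma)\,\sigma$, and let $S(\lambda)=(\mathbb Z S_n)\,b_{T_\lambda}a_{T_\lambda}$ be the corresponding Specht module (up to isomorphism it does not depend on the choice of $T_\lambda$). Then for every $n\geq 1$ there exist a chain of $\mathbb Z S_n$-submodules $$0=M_0\subseteq M_1\subseteq\dots\subseteq M_n=\frac{P_n(\mathbb Z)}{P_n(\mathbb Z)\cap \mathrm{Id}(G_R,\mathbb Z)}$$ and a bijection $i\mapsto k_i$ from $\{1,\dots,n\}$ onto $\{0,1,\dots,n-1\}$ such that, for each $i$, $$M_i/M_{i-1}\cong S(n-k_i,1^{k_i})/\ell\, S(n-k_i,1^{k_i})$$ as $\mathbb Z S_n$-modules. In other words, the factors of the chain are the modules $S(n-k,1^k)/\ell S(n-k,1^k)$, $0\leq k\leq n-1$, each occurring exactly once. -/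

import Mathlib

/-! ### The free ring, polynomial identities, multilinear polynomials -/

/-- The free associative ring `ℤ⟨X⟩` without unit on the countable set `X = {x₀, x₁, x₂, …}`: the
integral semigroup ring of the free semigroup (nonempty words) on `X`. -/
abbrev FreeRngInt : Type := MonoidAlgebra ℤ (FreeSemigroup ℕ)

/-- `Id(A, ℤ)`: the polynomial identities with integer coefficients of a (not necessarily unital)
ring `A`, i.e. the elements of `ℤ⟨X⟩` killed by every ring homomorphism `ℤ⟨X⟩ → A`. -/
def polynomialIdentities (A : Type*) [NonUnitalRing A] : Submodule ℤ FreeRngInt where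
  carrier := {f | ∀ ψ : FreeRngInt →ₙ+* A, ψ f = 0}
  zero_mem' := fun ψ => map_zero ψ
  add_mem' := fun {f g} hf hg ψ => by rw [map_add, hf ψ, hg ψ, add_zero]
  smul_mem' := fun c f hf ψ => by rw [map_zsmul, hf ψ, smul_zero]

/-- The group ring `ℤ Sₙ`. -/
abbrev IntSymGroupRing (n : ℕ) : Type := MonoidAlgebra ℤ (Equiv.Perm (Fin n))

/-- A permutation of `{0, …, n - 1}` regarded as a permutation of `ℕ` fixing all `i ≥ n`. -/
def permNat (n : ℕ) : Equiv.Perm (Fin n) →* Equiv.Perm ℕ :=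
  Equiv.Perm.extendDomainHom Fin.equivSubtype

theorem permNat_apply (n : ℕ) (σ : Equiv.Perm (Fin n)) (i : Fin n) :
    permNat n σ (i : ℕ) = (σ i : ℕ) :=
  Equiv.Perm.extendDomain_apply_image σ Fin.equivSubtype i

/-- The ring endomorphism of `ℤ⟨X⟩` with `x_i ↦ x_{σ(i)}` for `i < n` and `x_i ↦ x_i` for
`i ≥ n`. -/
noncomputable def renameVars (n : ℕ) (σ : Equiv.Perm (Fin n)) : FreeRngInt →ₙ+* FreeRngInt :=
  MonoidAlgebra.mapDomainNonUnitalRingHom ℤ (FreeSemigroup.map (permNat n σ))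

theorem renameVars_single (n : ℕ) (σ : Equiv.Perm (Fin n)) (w : FreeSemigroup ℕ) (c : ℤ) :
    renameVars n σ (MonoidAlgebra.single w c) =
      MonoidAlgebra.single (FreeSemigroup.map (permNat n σ) w) c :=
  MonoidAlgebra.mapDomain_single

theorem freeSemigroup_map_eq {f : ℕ → ℕ} (w : FreeSemigroup ℕ) :
    FreeSemigroup.map f w = ⟨f w.head, w.tail.map f⟩ := by
  induction w using FreeSemigroup.recOnMul with
  | ih1 x => rfl
  | ih2 x y hx hy => rw [map_mul, hy, hx]; ext <;> simp

/-- The action of `Sₙ` on `ℤ⟨X⟩` by permutations of the variables `x₀, …, x_{n-1}`. -/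
noncomputable def permVars (n : ℕ) : Representation ℤ (Equiv.Perm (Fin n)) FreeRngInt where
  toFun σ := (renameVars n σ).toAddMonoidHom.toIntLinearMap
  map_one' := by
    refine LinearMap.ext fun f => ?_
    suffices h : (renameVars n 1).toAddMonoidHom = AddMonoidHom.id _ from DFunLike.congr_fun h f
    refine MonoidAlgebra.addMonoidHom_ext fun w c => ?_
    change renameVars n 1 _ = _
    rw [renameVars_single, freeSemigroup_map_eq, map_one]
    simp
  map_mul' σ τ := by
    refine LinearMap.ext fun f => ?_
    suffices h : (renameVars n (σ * τ)).toAddMonoidHom =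
        (renameVars n σ).toAddMonoidHom.comp (renameVars n τ).toAddMonoidHom from
      DFunLike.congr_fun h f
    refine MonoidAlgebra.addMonoidHom_ext fun w c => ?_
    change renameVars n (σ * τ) _ = renameVars n σ (renameVars n τ _)
    rw [renameVars_single, renameVars_single, renameVars_single, freeSemigroup_map_eq,
      freeSemigroup_map_eq, freeSemigroup_map_eq, map_mul]
    simp

/-- `Pₙ(ℤ)` as an additive group: generated by the monomials `x_{σ(0)} x_{σ(1)} ⋯ x_{σ(n-1)}`,
`σ ∈ Sₙ`. -/
noncomputable def multilinearSpan (n : ℕ) : Submodule ℤ FreeRngInt :=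
  Submodule.span ℤ {f | ∃ (σ : Equiv.Perm (Fin n)) (w : FreeSemigroup ℕ),
    w.head :: w.tail = List.ofFn (fun i => (σ i : ℕ)) ∧ f = MonoidAlgebra.single w 1}

theorem renameVars_mem_multilinearSpan (n : ℕ) (σ : Equiv.Perm (Fin n)) (f : FreeRngInt)
    (hf : f ∈ multilinearSpan n) : renameVars n σ f ∈ multilinearSpan n := by
  have h : multilinearSpan n ≤
      (multilinearSpan n).comap (renameVars n σ).toAddMonoidHom.toIntLinearMap := by
    refine Submodule.span_le.2 ?_
    rintro _ ⟨τ, w, hw, rfl⟩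
    refine Submodule.subset_span ⟨σ * τ, FreeSemigroup.map (permNat n σ) w, ?_, ?_⟩
    · rw [freeSemigroup_map_eq]
      have := congrArg (List.map (permNat n σ)) hw
      simpa [List.map_ofFn, Function.comp_def, permNat_apply] using this
    · exact renameVars_single n σ w 1
  exact h hf

/-- `ℤ⟨X⟩` as a `ℤ Sₙ`-module. -/
abbrev FreeRngModule (n : ℕ) : Type := (permVars n).asModule

/-- `Pₙ(ℤ)` as a `ℤ Sₙ`-submodule of `ℤ⟨X⟩`. -/
noncomputable def multilinearPolys (n : ℕ) : Submodule (IntSymGroupRing n) (FreeRngModule n) :=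
  Subrepresentation.asSubmodule
    { toSubmodule := multilinearSpan n
      apply_mem_toSubmodule := fun σ f hf => renameVars_mem_multilinearSpan n σ f hf }

/-- `Id(A, ℤ)` as a `ℤ Sₙ`-submodule of `ℤ⟨X⟩`. -/
noncomputable def identitiesModule (A : Type*) [NonUnitalRing A] (n : ℕ) :
    Submodule (IntSymGroupRing n) (FreeRngModule n) :=
  Subrepresentation.asSubmodule
    { toSubmodule := polynomialIdentities A
      apply_mem_toSubmodule := fun σ _ hf ψ => hf (ψ.comp (renameVars n σ)) }

/-- The `ℤ Sₙ`-module `Pₙ(ℤ) / (Pₙ(ℤ) ∩ Id(A, ℤ))` of ordinary multilinear polynomial functions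
on the ring `A`. -/
abbrev MultilinearFunctions (A : Type*) [NonUnitalRing A] (n : ℕ) : Type :=
  ↥(multilinearPolys n) ⧸ (identitiesModule A n).submoduleOf (multilinearPolys n)

/-! ### The Grassmann algebra -/

/-- The relations `e_i e_j = - e_j e_i` for all `i, j ∈ ℕ` (including `i = j`). -/
inductive GrassmannRel (R : Type*) [CommRing R] : FreeAlgebra R ℕ → FreeAlgebra R ℕ → Prop
  | anticomm (i j : ℕ) : GrassmannRel R (FreeAlgebra.ι R i * FreeAlgebra.ι R j)
      (-(FreeAlgebra.ι R j * FreeAlgebra.ι R i))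

/-- The Grassmann algebra `G_R`: the unital associative `R`-algebra with generators `e_i`, `i ∈ ℕ`,
and the relations `e_i e_j = - e_j e_i`. -/
abbrev GrassmannAlgebra (R : Type*) [CommRing R] : Type _ := RingQuot (GrassmannRel R)

/-! ### Specht modules over `ℤ` -/

/-- A Young tableau of shape `μ` filled with `0, …, n - 1`, each number once: the number `i` stands
in the box `T i = (row, column)`. -/
abbrev YoungTableau (n : ℕ) (μ : YoungDiagram) : Type := Fin n ≃ {c : ℕ × ℕ // c ∈ μ}

/-- The row stabilizer `R_T`. -/
def rowStabilizer {n : ℕ} {μ : YoungDiagram} (T : YoungTableau n μ) :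
    Subgroup (Equiv.Perm (Fin n)) where
  carrier := {π | ∀ i, (T (π i)).1.1 = (T i).1.1}
  one_mem' := fun _ => rfl
  mul_mem' := fun {π ρ} hπ hρ i => (hπ (ρ i)).trans (hρ i)
  inv_mem' := fun {π} hπ i => by simpa using (hπ (π⁻¹ i)).symm

/-- The column stabilizer `C_T`. -/
def colStabilizer {n : ℕ} {μ : YoungDiagram} (T : YoungTableau n μ) :
    Subgroup (Equiv.Perm (Fin n)) where
  carrier := {π | ∀ i, (T (π i)).1.2 = (T i).1.2}
  one_mem' := fun _ => rfl
  mul_mem' := fun {π ρ} hπ hρ i => (hπ (ρ i)).trans (hρ i)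
  inv_mem' := fun {π} hπ i => by simpa using (hπ (π⁻¹ i)).symm

open Classical in
/-- `a_T = ∑_{π ∈ R_T} π`. -/
noncomputable def rowSymmetrizer {n : ℕ} {μ : YoungDiagram} (T : YoungTableau n μ) :
    IntSymGroupRing n :=
  ∑ π : Equiv.Perm (Fin n) with π ∈ rowStabilizer T, MonoidAlgebra.single π 1

open Classical in
/-- `b_T = ∑_{σ ∈ C_T} (sign σ) σ`. -/
noncomputable def colAntisymmetrizer {n : ℕ} {μ : YoungDiagram} (T : YoungTableau n μ) :
    IntSymGroupRing n :=
  ∑ σ : Equiv.Perm (Fin n) with σ ∈ colStabilizer T,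
    MonoidAlgebra.single σ (Equiv.Perm.sign σ : ℤ)

/-- The Specht module `(ℤ Sₙ) b_T a_T`, a left ideal of `ℤ Sₙ`. -/
noncomputable def spechtModule {n : ℕ} {μ : YoungDiagram} (T : YoungTableau n μ) :
    Submodule (IntSymGroupRing n) (IntSymGroupRing n) :=
  Submodule.span (IntSymGroupRing n) {colAntisymmetrizer T * rowSymmetrizer T}

/-- The submodule `ℓ S` of a module `S`. -/
def multiplesSubmodule (A S : Type*) [Ring A] [AddCommGroup S] [Module A S] (l : ℕ) :
    Submodule A S :=
  LinearMap.range (l • (LinearMap.id : S →ₗ[A] S))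

/-- The hook diagram of the partition `(n - k, 1^k)` of `n`, where `k < n`. -/
def hookDiagram (n : ℕ) (k : Fin n) : YoungDiagram :=
  YoungDiagram.ofRowLens ((n - (k : ℕ)) :: List.replicate (k : ℕ) 1) <| by
    have hk := k.2
    refine List.Pairwise.sortedGE (List.pairwise_cons.2 ⟨fun a ha => ?_, ?_⟩)
    · rw [List.eq_of_mem_replicate ha]
      omega
    · exact List.pairwise_replicate.2 (Or.inr le_rfl)

theorem mem_hookDiagram (n : ℕ) (k : Fin n) (c : ℕ × ℕ) :
    c ∈ hookDiagram n k ↔ (c.1 = 0 ∧ c.2 < n - k) ∨ (1 ≤ c.1 ∧ c.1 ≤ k ∧ c.2 = 0) := by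
  obtain ⟨i, j⟩ := c
  rw [hookDiagram, YoungDiagram.mem_ofRowLens]
  cases i with
  | zero => simp
  | succ i => simp

/-- There are tableaux of shape `(n - k, 1^k)`. -/
theorem nonempty_hookTableau (n : ℕ) (k : Fin n) : Nonempty (YoungTableau n (hookDiagram n k)) := by
  have hk := k.2
  refine ⟨
    { toFun := fun i => ⟨if (i : ℕ) < n - k then (0, (i : ℕ)) else ((i : ℕ) - (n - k) + 1, 0), ?_⟩
      invFun := fun c => ⟨if c.1.1 = 0 then c.1.2 else c.1.1 - 1 + (n - k), ?_⟩
      left_inv := ?_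
      right_inv := ?_ }⟩
  · have := i.2
    rw [mem_hookDiagram]
    split_ifs <;> simp <;> omega
  · have := (mem_hookDiagram n k c.1).1 c.2
    split_ifs <;> omega
  · intro i
    ext
    by_cases h : (i : ℕ) < n - k
    · simp [h]
    · simp [h]; omega
  · rintro ⟨⟨i, j⟩, hc⟩
    have := (mem_hookDiagram n k (i, j)).1 hc
    by_cases h : i = 0
    · have hj : j < n - k := by simp_all
      simp [h, hj]
    · have hj : j = 0 := by simp_all
      simp [h, hj]; omega

/-! ### Words in variables `a i + b i` with `a i` central and `b i` anticommuting -/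

/-! Every element of the Grassmann algebra is a sum `a + b` with `a` even, hence central, and `b`
odd. The commutator of two such elements is `2 b b'`, so sorting a word in `a i + b i` expresses it
integrally through the elements `2^(|J|/2) b_J ∏_{i ∉ J} (a i + b i)` with `|J|` even
(`superWord_mem`). Conversely these elements are values of integral multilinear polynomials, being
built from commutators (`mul_superWord_mem`). At `x_i = 1 + e_i` in the exterior algebra, the one
indexed by `J` has lowest term `2^(|J|/2) e_J`, so the coefficients can be read off degree by degree
as soon as 2 can be cancelled, which is where the characteristic matters
(`coeff_eq_zero_of_extProj_eq_zero`). Hence the identities in `ℤ Sₙ` are those over `ℤ` plus the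
multiples of `ℓ` (`forall_evalWords_eq_zero_iff`).

Filtering by lowest degree, one finds in each even degree `k` a copy of `Λ^k(ℤⁿ)`, up to a power of
2. Contraction with the sum of coordinates makes `Λ(ℤⁿ)` an exact complex of `Sₙ`-modules. With
`B_k` the image of `Λ^(k+1)`, each `Λ^k` is an extension of `B_(k-1)` by `B_k`. Even `k` therefore
give every `B_k` with `k < n` exactly once (`hookMap_eq_two_pow_smul`,
`exists_hookMap_eq_two_pow_smul`).

Finally `B_k` is the Specht module of `(n - k, 1^k)`: it is generated by the boundary of the wedge
of the first column, and the coefficients of `x b_T a_T` are the coordinates of `x` times that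
boundary (`coeff_mul_colAntisymmetrizer_mul_rowSymmetrizer`), so the two generators have the same
annihilator. Torsion-freeness of the exterior algebra makes reduction modulo `ℓ` compatible with the
filtration. -/

section SuperWords

variable {ι A : Type*} [Ring A]

/-- The `a i` commute with everything in sight and the `b i` anticommute. -/
structure IsSupercommuting (a b : ι → A) : Prop where
  even_even : ∀ i j, a i * a j = a j * a i
  even_odd : ∀ i j, a i * b j = b j * a i
  odd_odd : ∀ i j, b i * b j = -(b j * b i)

/-- `2 ^ ⌊|J| / 2⌋ • ∏ i ∈ J, b i * ∏ i ∈ r, (a i + b i)`. -/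
def superWord (a b : ι → A) (J r : List ι) : A :=
  (2 ^ (J.length / 2) : ℤ) • ((J.map b).prod * (r.map (a + b)).prod)

variable {a b : ι → A} (h : IsSupercommuting a b)

include h

/-- Moving `b k` past two odd factors changes the sign twice. -/
theorem IsSupercommuting.commute_odd_mul_odd (i j k : ι) :
    Commute (b i * b j) ((a + b) k) := by
  have h1 := h.even_odd k i
  have h2 := h.even_odd k j
  have h3 := h.odd_odd i k
  have h4 := h.odd_odd j k
  rw [Pi.add_apply]
  refine Commute.add_right ?_ ?_
  · change b i * b j * a k = a k * (b i * b j)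
    rw [← mul_assoc, h1, mul_assoc, mul_assoc, h2]
  · change b i * b j * b k = b k * (b i * b j)
    rw [mul_assoc, h4, mul_neg, ← mul_assoc, h3, neg_mul, neg_neg, mul_assoc]

/-- Even parts drop out of the commutator, leaving twice the odd product. All powers of 2 below come
from here. -/
theorem IsSupercommuting.swap (i j : ι) :
    (a + b) i * (a + b) j = (a + b) j * (a + b) i + (2 : ℤ) • (b i * b j) := by
  have h0 := h.even_even i j
  have h1 := h.even_odd i j
  have h2 := h.even_odd j i
  have h3 := h.odd_odd j i
  simp only [Pi.add_apply, add_mul, mul_add, two_smul, h0, h1, h2, h3]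
  abel

/-- The commutator `2 b i b j` moves to the front and joins `J`. Its factor 2 is exactly the growth
of the normalising power of 2, so the error term has coefficient 1. -/
theorem superWord_swap (J p s : List ι) (i j : ι) :
    superWord a b J (p ++ i :: j :: s) =
      superWord a b J (p ++ j :: i :: s) + superWord a b (J ++ [i, j]) (p ++ s) := by
  have hc : Commute (b i * b j) (p.map (a + b)).prod := by
    refine Commute.list_prod_right _ _ fun y hy => ?_
    obtain ⟨k, -, rfl⟩ := List.mem_map.1 hy
    exact h.commute_odd_mul_odd i j k
  have hl : (J ++ [i, j]).length / 2 = J.length / 2 + 1 := by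
    rw [List.length_append]; simp
  unfold superWord
  rw [hl, pow_succ, mul_smul, ← smul_add]
  congr 1
  simp only [List.map_append, List.prod_append, List.map_cons, List.prod_cons, List.map_nil,
    List.prod_nil, mul_one]
  have e1 : (a + b) i * ((a + b) j * (s.map (a + b)).prod) =
      (a + b) j * ((a + b) i * (s.map (a + b)).prod) +
        (2 : ℤ) • (b i * b j) * (s.map (a + b)).prod := by
    rw [← mul_assoc, h.swap i j, add_mul, mul_assoc]
  rw [e1, mul_add, mul_add]
  congr 1
  rw [smul_mul_assoc, mul_smul_comm, mul_smul_comm, ← mul_assoc (p.map _).prod, ← hc.eq]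
  simp only [mul_assoc]

theorem prod_odd_perm {J J' : List ι} (hJ : J.Perm J') :
    ∃ u : ℤˣ, (J.map b).prod = (u : ℤ) • (J'.map b).prod := by
  induction hJ with
  | nil => exact ⟨1, by simp⟩
  | cons x _ ih =>
    obtain ⟨u, hu⟩ := ih
    exact ⟨u, by rw [List.map_cons, List.prod_cons, hu, mul_smul_comm, List.map_cons,
      List.prod_cons]⟩
  | swap x y l =>
    refine ⟨-1, ?_⟩
    simp only [List.map_cons, List.prod_cons, ← mul_assoc, h.odd_odd y x]
    simp
  | trans _ _ ih1 ih2 =>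
    obtain ⟨u, hu⟩ := ih1
    obtain ⟨v, hv⟩ := ih2
    exact ⟨u * v, by simp [hu, hv, mul_smul]⟩

/-- Adjacent swaps sort `r`; each error term has two letters fewer outside `J` and is covered by
`ih`. The prefix `p` carries the letters that the permutation induction has already passed. -/
theorem superWord_perm_mem_iff {L₀ : List ι} (S : AddSubgroup A) {r r' : List ι}
    (hr : r.Perm r') (J p : List ι) (hJ : Even J.length) (hL : (J ++ (p ++ r)).Perm L₀)
    (ih : ∀ J' r'', r''.length < (p ++ r).length → Even J'.length → (J' ++ r'').Perm L₀ →
      superWord a b J' r'' ∈ S) :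
    superWord a b J (p ++ r) ∈ S ↔ superWord a b J (p ++ r') ∈ S := by
  induction hr generalizing p with
  | nil => rfl
  | @cons x l l' _ hl =>
    have := hl (p ++ [x]) (by simpa using hL) (fun J' r'' h1 => ih J' r'' (by simpa using h1))
    simpa using this
  | swap x y l =>
    rw [superWord_swap h]
    refine AddSubgroup.add_mem_cancel_right _ (ih _ _ (by simp) ?_ ?_)
    · rw [List.length_append]
      exact hJ.add (by simp)
    · refine List.Perm.trans ?_ hL
      rw [List.append_assoc]
      refine List.Perm.append_left J ?_
      have : ([y, x] ++ (p ++ l)).Perm (p ++ ([y, x] ++ l)) := by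
        rw [← List.append_assoc, ← List.append_assoc]
        exact (List.perm_append_comm).append_right l
      simpa using this
  | @trans l₁ l₂ l₃ h12 _ ih1 ih2 =>
    refine (ih1 p hL ih).trans (ih2 p ?_ ?_)
    · exact (((h12.symm).append_left p).append_left J).trans hL
    · intro J' r'' h1
      refine ih J' r'' ?_
      simpa [h12.length_eq] using h1

variable [LinearOrder ι] [Fintype ι]

omit h in
/-- The standard spanning elements of the multilinear words. -/
def superMonomial (a b : ι → A) (J : Finset ι) : A := superWord a b J.sort Jᶜ.sort

/-- Induction on the number of letters outside `J`: sorting them produces only shorter words, and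
sorting `J` costs only a sign. -/
theorem superWord_mem (S : AddSubgroup A)
    (hS : ∀ J : Finset ι, Even J.card → superMonomial a b J ∈ S) (N : ℕ) (J r : List ι)
    (hN : r.length < N) (hJ : Even J.length)
    (hL : (J ++ r).Perm (Finset.univ : Finset ι).toList) : superWord a b J r ∈ S := by
  induction N generalizing J r with
  | zero => omega
  | succ N ih =>
    have hnd : (J ++ r).Nodup := hL.nodup_iff.2 (Finset.nodup_toList _)
    have hJn : J.Nodup := (List.nodup_append.1 hnd).1
    have hrn : r.Nodup := (List.nodup_append.1 hnd).2.1
    have hr : r.Perm (J.toFinsetᶜ).sort := by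
      refine (List.perm_ext_iff_of_nodup hrn (Finset.sort_nodup _ _)).2 fun i => ?_
      have h1 : i ∈ J ++ r := hL.mem_iff.2 (by simp)
      have h2 := (List.nodup_append.1 hnd).2.2
      simp only [Finset.mem_sort, Finset.mem_compl, List.mem_toFinset]
      rw [List.mem_append] at h1
      constructor
      · intro hi hi'
        exact h2 _ hi' _ hi rfl
      · tauto
    have hJs : J.Perm J.toFinset.sort := by
      refine (List.perm_ext_iff_of_nodup hJn (Finset.sort_nodup _ _)).2 fun i => ?_
      simp
    have key := superWord_perm_mem_iff h (L₀ := (Finset.univ : Finset ι).toList) S hr J [] hJ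
      (by simpa using hL)
      (fun J' r'' h1 h2 h3 => ih J' r'' (by simp at h1; omega) h2 h3)
    rw [List.nil_append, List.nil_append] at key
    rw [key]
    obtain ⟨u, hu⟩ := prod_odd_perm h hJs
    have hc : J.toFinset.card = J.length := List.toFinset_card_of_nodup hJn
    have e1 : superWord a b J (J.toFinsetᶜ).sort = (u : ℤ) • superMonomial a b J.toFinset := by
      unfold superMonomial superWord
      rw [hu, Finset.length_sort, hc, smul_mul_assoc, smul_comm]
    rw [e1]
    exact S.zsmul_mem (hS _ (by rwa [hc])) _

omit [LinearOrder ι] [Fintype ι] in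
-- Reverse direction: each pair taken from `J`, with its factor 2, is a commutator, so it expands
-- into a difference of two words. The prefix `p` collects the letters already expanded.
theorem mul_superWord_mem {L₀ : List ι} (S : AddSubgroup A)
    (hS : ∀ w : List ι, w.Perm L₀ → (w.map (a + b)).prod ∈ S) :
    ∀ J p r : List ι, Even J.length → (p ++ (J ++ r)).Perm L₀ →
      (p.map (a + b)).prod * superWord a b J r ∈ S
  | [], p, r, _, hL => by
    have := hS _ hL
    simpa [superWord] using this
  | [i], p, r, hJ, _ => by simp at hJ
  | i :: j :: J, p, r, hJ, hL => by
    have hJ' : Even J.length := by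
      have : (i :: j :: J).length = J.length + 2 := rfl
      rw [this] at hJ
      exact (Nat.even_add.1 hJ).2 even_two
    have h1 := mul_superWord_mem S hS J (p ++ [i, j]) r hJ' (by simpa using hL)
    have h2 := mul_superWord_mem S hS J (p ++ [j, i]) r hJ' (by
      refine List.Perm.trans ?_ hL
      simpa using (List.Perm.swap i j (J ++ r)).append_left p)
    have e : superWord a b (i :: j :: J) r =
        (2 : ℤ) • (b i * b j) * superWord a b J r := by
      have hl : (i :: j :: J).length / 2 = J.length / 2 + 1 := by
        rw [List.length_cons, List.length_cons]; omega
      unfold superWord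
      rw [hl, pow_succ, mul_smul, mul_smul_comm, smul_mul_assoc]
      simp only [mul_assoc, List.map_cons, List.prod_cons]
    have e2 : (2 : ℤ) • (b i * b j) = (a + b) i * (a + b) j - (a + b) j * (a + b) i := by
      rw [h.swap i j]; abel
    rw [e, e2]
    have := S.sub_mem h1 h2
    simp only [List.map_append, List.prod_append, List.map_cons, List.map_nil, List.prod_cons,
      List.prod_nil, mul_one] at this
    rw [sub_mul, mul_sub]
    simpa only [mul_assoc] using this

end SuperWords

/-! ### Values of multilinear polynomials, encoded by `ℤ Sₙ` -/

section EvalWords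

variable {A : Type*} [Ring A] {n : ℕ}

/-- The value `∑ σ, f σ • x_{σ 0} ⋯ x_{σ (n - 1)}` of a multilinear polynomial. -/
noncomputable def evalWords (x : Fin n → A) : IntSymGroupRing n →ₗ[ℤ] A :=
  (Finsupp.linearCombination ℤ fun σ : Equiv.Perm (Fin n) => (List.ofFn fun i => x (σ i)).prod) ∘ₗ
    (MonoidAlgebra.coeffLinearEquiv ℤ).toLinearMap

theorem evalWords_single (x : Fin n → A) (σ : Equiv.Perm (Fin n)) (c : ℤ) :
    evalWords x (MonoidAlgebra.single σ c) = c • (List.ofFn fun i => x (σ i)).prod := by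
  simp [evalWords]

theorem map_evalWords {B : Type*} [Ring B] (φ : A →+* B) (x : Fin n → A) (f : IntSymGroupRing n) :
    φ (evalWords x f) = evalWords (φ ∘ x) f := by
  induction f using MonoidAlgebra.induction_linear with
  | zero => simp
  | add f g hf hg => simp [hf, hg]
  | single σ c =>
    rw [evalWords_single, evalWords_single, map_zsmul, map_list_prod, List.map_ofFn]
    rfl

theorem perm_univ_iff_exists_ofFn (w : List (Fin n)) :
    w.Perm (Finset.univ : Finset (Fin n)).toList ↔
      ∃ σ : Equiv.Perm (Fin n), w = List.ofFn fun i => σ i := by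
  constructor
  · intro hw
    have hl : w.length = n := by simpa using hw.length_eq
    have hnd : w.Nodup := hw.nodup_iff.2 (Finset.nodup_toList _)
    have hinj : Function.Injective fun i : Fin n => w.get (i.cast hl.symm) :=
      (List.nodup_iff_injective_get.1 hnd).comp (Fin.cast_injective _)
    refine ⟨Equiv.ofBijective _ (Finite.injective_iff_bijective.1 hinj), ?_⟩
    refine List.ext_getElem (by simp [hl]) fun i h1 h2 => ?_
    simp
  · rintro ⟨σ, rfl⟩
    refine (List.perm_ext_iff_of_nodup ?_ (Finset.nodup_toList _)).2 fun i => ?_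
    · exact List.nodup_ofFn.2 σ.injective
    · simp only [List.mem_ofFn, Finset.mem_toList, Finset.mem_univ, iff_true]
      exact ⟨σ.symm i, by simp⟩

variable {a b : Fin n → A} (h : IsSupercommuting a b)

include h

theorem exists_evalWords_eq_superMonomial (J : Finset (Fin n)) (hJ : Even J.card) :
    ∃ f : IntSymGroupRing n, evalWords (a + b) f = superMonomial a b J := by
  have key := mul_superWord_mem h (L₀ := (Finset.univ : Finset (Fin n)).toList)
    (LinearMap.range (evalWords (a + b))).toAddSubgroup (fun w hw => by
      obtain ⟨σ, rfl⟩ := (perm_univ_iff_exists_ofFn w).1 hw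
      refine ⟨MonoidAlgebra.single σ 1, ?_⟩
      rw [evalWords_single, one_smul, List.map_ofFn]
      rfl) J.sort [] Jᶜ.sort (by simpa using hJ) (by
      refine (List.perm_ext_iff_of_nodup ?_ (Finset.nodup_toList _)).2 fun i => ?_
      · rw [List.nil_append, List.nodup_append]
        refine ⟨Finset.sort_nodup _ _, Finset.sort_nodup _ _, fun i hi j hj hij => ?_⟩
        subst hij
        simp only [Finset.mem_sort, Finset.mem_compl] at hi hj
        exact hj hi
      · simp [em])
  simpa [superMonomial] using key

theorem evalWords_mem_span_superMonomial (f : IntSymGroupRing n) :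
    ∃ c : {J : Finset (Fin n) // Even J.card} → ℤ,
      evalWords (a + b) f = ∑ J, c J • superMonomial a b J := by
  suffices hf : evalWords (a + b) f ∈ Submodule.span ℤ
      (Set.range fun J : {J : Finset (Fin n) // Even J.card} => superMonomial a b (J : Finset _)) by
    obtain ⟨c, hc⟩ := (Submodule.mem_span_range_iff_exists_fun ℤ).1 hf
    exact ⟨c, hc.symm⟩
  induction f using MonoidAlgebra.induction_linear with
  | zero => simp
  | add f g hf hg => rw [map_add]; exact add_mem hf hg
  | single σ c =>
    rw [evalWords_single]
    refine Submodule.smul_mem _ _ ?_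
    have := superWord_mem h (Submodule.span ℤ (Set.range
      fun J : {J : Finset (Fin n) // Even J.card} =>
        superMonomial a b (J : Finset _))).toAddSubgroup
      (fun J hJ => Submodule.subset_span ⟨⟨J, hJ⟩, rfl⟩) _ [] (List.ofFn fun i => σ i)
      (Nat.lt_succ_self _) (by simp) ((perm_univ_iff_exists_ofFn _).2 ⟨σ, rfl⟩)
    simpa [superWord, List.map_ofFn, Function.comp_def] using this

end EvalWords

/-! ### The exterior algebra of `Rⁿ` -/

section Exterior

variable (R : Type*) [CommRing R] (n : ℕ)

/-- The exterior algebra of `Rⁿ`. -/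
abbrev ExtAlg : Type _ := ExteriorAlgebra R (Fin n → R)

variable {n}

/-- The standard generators of the exterior algebra of `Rⁿ`. -/
noncomputable def extGen (i : Fin n) : ExtAlg R n := ExteriorAlgebra.ι R (Pi.single i 1)

theorem extGen_isSupercommuting : IsSupercommuting (1 : Fin n → ExtAlg R n) (extGen R) where
  even_even _ _ := rfl
  even_odd i j := by simp
  odd_odd i j := eq_neg_of_add_eq_zero_left (ExteriorAlgebra.ι_add_mul_swap _ _)

/-- The product of generators along a list. -/
noncomputable def extWord (w : List (Fin n)) : ExtAlg R n := (w.map (extGen R)).prod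

theorem extWord_cons (i : Fin n) (w : List (Fin n)) :
    extWord R (i :: w) = extGen R i * extWord R w := rfl

theorem extWord_append (v w : List (Fin n)) :
    extWord R (v ++ w) = extWord R v * extWord R w := by
  simp [extWord]

theorem extWord_ofFn {k : ℕ} (c : Fin k → Fin n) :
    extWord R (List.ofFn c) = ExteriorAlgebra.ιMulti R k fun i => Pi.single (c i) 1 := by
  rw [ExteriorAlgebra.ιMulti_apply, extWord, List.map_ofFn]
  rfl

theorem extWord_eq_zero {w : List (Fin n)} (hw : ¬ w.Nodup) : extWord R w = 0 := by
  rw [← List.ofFn_get w, extWord_ofFn]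
  refine ExteriorAlgebra.ιMulti_eq_zero_of_not_inj fun hinj => hw ?_
  refine List.nodup_iff_injective_get.2 fun i j hij => hinj ?_
  simp only [hij]

theorem extWord_mem (w : List (Fin n)) : extWord R w ∈ ⋀[R]^w.length (Fin n → R) := by
  rw [← List.ofFn_get w, extWord_ofFn, List.length_ofFn]
  exact ExteriorAlgebra.ιMulti_range R _ ⟨_, rfl⟩

theorem sort_eq_ofFn {J : Finset (Fin n)} {k : ℕ} (hJ : J.card = k) :
    J.sort = List.ofFn (J.orderEmbOfFin hJ) := by
  subst hJ
  refine List.ext_getElem (by simp) fun i h1 h2 => ?_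
  simp [Finset.orderEmbOfFin_apply]

/-- Identifies basis vectors with sorted words, which reduces statements about linear maps to words.
-/
theorem extBasis_apply (J : Finset (Fin n)) :
    (Pi.basisFun R (Fin n)).ExteriorAlgebra J = extWord R J.sort := by
  rw [ExteriorAlgebra.basis_apply_ofCard _ rfl, sort_eq_ofFn rfl, extWord_ofFn, ExteriorAlgebra.ιMulti_family]
  congr 1
  funext i
  simp [Set.powersetCard.ofFinEmbEquiv_symm_apply]

theorem extAlg_linearMap_ext {M : Type*} [AddCommGroup M] [Module R M] {f g : ExtAlg R n →ₗ[R] M}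
    (h : ∀ w : List (Fin n), f (extWord R w) = g (extWord R w)) : f = g :=
  (Pi.basisFun R (Fin n)).ExteriorAlgebra.ext fun J => by rw [extBasis_apply, h]

/-- The projection onto the component of degree `k`. -/
noncomputable def extProj (k : ℕ) : ExtAlg R n →ₗ[R] ExtAlg R n :=
  GradedAlgebra.proj (fun i : ℕ => ⋀[R]^i (Fin n → R)) k

theorem extProj_of_mem {k : ℕ} {x : ExtAlg R n} (hx : x ∈ ⋀[R]^k (Fin n → R)) :
    extProj R k x = x := by
  rw [extProj, GradedAlgebra.proj_apply]
  exact DirectSum.decompose_of_mem_same (fun i : ℕ => ⋀[R]^i (Fin n → R)) hx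

theorem extProj_of_mem_ne {j k : ℕ} {x : ExtAlg R n} (hx : x ∈ ⋀[R]^j (Fin n → R)) (hjk : j ≠ k) :
    extProj R k x = 0 := by
  rw [extProj, GradedAlgebra.proj_apply]
  exact DirectSum.decompose_of_mem_ne (fun i : ℕ => ⋀[R]^i (Fin n → R)) hx hjk

theorem extProj_extWord (k : ℕ) (w : List (Fin n)) :
    extProj R k (extWord R w) = if w.length = k then extWord R w else 0 := by
  split_ifs with h
  · subst h
    exact extProj_of_mem R (extWord_mem R w)
  · exact extProj_of_mem_ne R (extWord_mem R w) h

/-- Contraction with the linear form `∑ i, x i`. -/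
noncomputable def extContract : ExtAlg R n →ₗ[R] ExtAlg R n :=
  CliffordAlgebra.contractLeft (Q := (0 : QuadraticForm R (Fin n → R)))
    (∑ i, LinearMap.proj i : (Fin n → R) →ₗ[R] R)

/-- The antiderivation rule; the linear form takes the value 1 on every generator. -/
theorem extContract_gen_mul (i : Fin n) (x : ExtAlg R n) :
    extContract R (extGen R i * x) = x - extGen R i * extContract R x := by
  have := CliffordAlgebra.contractLeft_ι_mul (Q := (0 : QuadraticForm R (Fin n → R)))
    (d := (∑ i, LinearMap.proj i : (Fin n → R) →ₗ[R] R)) (Pi.single i 1) x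
  rwa [show (∑ i, LinearMap.proj i : (Fin n → R) →ₗ[R] R) (Pi.single i 1) = 1 by simp,
    one_smul] at this

theorem extContract_extContract (x : ExtAlg R n) : extContract R (extContract R x) = 0 :=
  CliffordAlgebra.contractLeft_contractLeft _ x

theorem extContract_one : extContract R (1 : ExtAlg R n) = 0 :=
  CliffordAlgebra.contractLeft_one (Q := (0 : QuadraticForm R (Fin n → R))) _

/-- Multiplication by any single generator is a contracting homotopy, so the complex is exact over
any base, without division by `n`. -/
theorem eq_extContract_of_extContract_eq_zero (i : Fin n) {x : ExtAlg R n}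
    (hx : extContract R x = 0) : x = extContract R (extGen R i * x) := by
  rw [extContract_gen_mul, hx, mul_zero, sub_zero]

theorem extGen_mul_mem {k : ℕ} (i : Fin n) {x : ExtAlg R n} (hx : x ∈ ⋀[R]^k (Fin n → R)) :
    extGen R i * x ∈ ⋀[R]^(k + 1) (Fin n → R) := by
  rw [add_comm]
  refine SetLike.mul_mem_graded (A := fun i : ℕ => ⋀[R]^i (Fin n → R)) ?_ hx
  simpa [extWord] using extWord_mem R [i]

theorem extContract_extWord_mem (w : List (Fin n)) (k : ℕ) (hw : w.length = k + 1) :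
    extContract R (extWord R w) ∈ ⋀[R]^k (Fin n → R) := by
  induction w generalizing k with
  | nil => simp at hw
  | cons i w ih =>
    have hk : w.length = k := by simpa using hw
    rw [extWord_cons, extContract_gen_mul]
    refine sub_mem (hk ▸ extWord_mem R w) ?_
    cases k with
    | zero =>
      rw [List.length_eq_zero_iff] at hk
      subst hk
      simp [extWord, extContract_one]
    | succ k => exact extGen_mul_mem R i (ih k hk)

theorem extProj_extContract (k : ℕ) (x : ExtAlg R n) :
    extProj R k (extContract R x) = extContract R (extProj R (k + 1) x) := by
  suffices h : extProj R k ∘ₗ extContract R = extContract R ∘ₗ extProj R (n := n) (k + 1) from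
    LinearMap.congr_fun h x
  refine extAlg_linearMap_ext R fun w => ?_
  rw [LinearMap.comp_apply, LinearMap.comp_apply, extProj_extWord]
  split_ifs with h
  · exact extProj_of_mem R (extContract_extWord_mem R w k h)
  · rw [map_zero]
    rcases hw : w.length with _ | j
    · rw [List.length_eq_zero_iff] at hw
      subst hw
      simp [extWord, extContract_one]
    · exact extProj_of_mem_ne R (extContract_extWord_mem R w j hw) (by omega)

theorem extProj_gen_mul (i : Fin n) (k : ℕ) (x : ExtAlg R n) :
    extProj R (k + 1) (extGen R i * x) = extGen R i * extProj R k x := by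
  suffices h : extProj R (k + 1) ∘ₗ LinearMap.mulLeft R (extGen R i) =
      LinearMap.mulLeft R (extGen R i) ∘ₗ extProj R (n := n) k from LinearMap.congr_fun h x
  refine extAlg_linearMap_ext R fun w => ?_
  simp only [LinearMap.comp_apply, LinearMap.mulLeft_apply]
  rw [← extWord_cons, extProj_extWord, extProj_extWord, List.length_cons]
  simp [extWord_cons]

theorem extProj_extProj (k : ℕ) (x : ExtAlg R n) :
    extProj R k (extProj R k x) = extProj R k x := by
  suffices h : extProj R k ∘ₗ extProj R k = extProj R (n := n) k from LinearMap.congr_fun h x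
  refine extAlg_linearMap_ext R fun w => ?_
  rw [LinearMap.comp_apply, extProj_extWord]
  split_ifs with h <;> simp [extProj_extWord, h]

theorem extContract_extProj_zero (x : ExtAlg R n) : extContract R (extProj R 0 x) = 0 := by
  suffices h : extContract R ∘ₗ extProj R 0 = (0 : ExtAlg R n →ₗ[R] ExtAlg R n) from
    LinearMap.congr_fun h x
  refine extAlg_linearMap_ext R fun w => ?_
  rw [LinearMap.comp_apply, extProj_extWord]
  split_ifs with h
  · rw [List.length_eq_zero_iff] at h
    subst h
    simp [extWord, extContract_one]
  · simp

theorem extProj_eq_zero_of_lt {k : ℕ} (hk : n < k) (x : ExtAlg R n) : extProj R k x = 0 := by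
  suffices h : extProj R k = (0 : ExtAlg R n →ₗ[R] ExtAlg R n) from LinearMap.congr_fun h x
  refine extAlg_linearMap_ext R fun w => ?_
  rw [extProj_extWord]
  split_ifs with h
  · refine extWord_eq_zero R fun hw => ?_
    have := hw.length_le_card
    rw [Fintype.card_fin] at this
    omega
  · rfl

/-- Expansion of `e_v * ∏ (1 + e_i)` by degree. -/
theorem extProj_extWord_mul_prod (v w : List (Fin n)) (k : ℕ) (hk : k ≤ v.length) :
    extProj R k (extWord R v * (w.map (1 + extGen R)).prod) =
      if v.length = k then extWord R v else 0 := by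
  induction w generalizing v with
  | nil => simp [extProj_extWord]
  | cons i w ih =>
    have e : extWord R v * ((i :: w).map (1 + extGen R)).prod =
        extWord R v * (w.map (1 + extGen R)).prod +
          extWord R (v ++ [i]) * (w.map (1 + extGen R)).prod := by
      rw [extWord_append, List.map_cons, List.prod_cons, Pi.add_apply, Pi.one_apply, add_mul,
        one_mul, mul_add]
      simp [extWord, mul_assoc]
    rw [e, map_add, ih v hk, ih _ (by rw [List.length_append]; omega), List.length_append,
      if_neg (by simp; omega : ¬ (v.length + [i].length = k)), add_zero]

/-- The factors `1 + e_i` have constant term 1, so the lowest term is a multiple of `e_J`; nothing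
is claimed in degrees above `|J|`. -/
theorem extProj_superMonomial (J : Finset (Fin n)) (k : ℕ) (hk : k ≤ J.card) :
    extProj R k (superMonomial 1 (extGen R) J) =
      if J.card = k then (2 ^ (k / 2) : ℤ) • (Pi.basisFun R (Fin n)).ExteriorAlgebra J else 0 := by
  have := extProj_extWord_mul_prod R J.sort Jᶜ.sort k (by simpa using hk)
  rw [superMonomial, superWord, map_zsmul, ← extWord, this, extBasis_apply, Finset.length_sort]
  split_ifs with h
  · rw [h]
  · rw [smul_zero]

/-- Triangularity: smaller `J` are excluded by `hc`, and larger `J` start in higher degree. -/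
theorem extProj_sum_superMonomial (c : {J : Finset (Fin n) // Even J.card} → ℤ) (k : ℕ)
    (hc : ∀ J : {J : Finset (Fin n) // Even J.card},
      (J : Finset (Fin n)).card < k → (c J : R) = 0) :
    extProj R k (∑ J, c J • superMonomial 1 (extGen R) (J : Finset (Fin n))) =
      (2 ^ (k / 2) : ℤ) • ∑ J : {J : Finset (Fin n) // Even J.card},
        if (J : Finset (Fin n)).card = k then c J • (Pi.basisFun R (Fin n)).ExteriorAlgebra J else 0 := by
  rw [map_sum, Finset.smul_sum]
  refine Finset.sum_congr rfl fun J _ => ?_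
  rw [map_zsmul]
  rcases lt_or_ge (J : Finset (Fin n)).card k with h | h
  · rw [if_neg h.ne, ← Int.cast_smul_eq_zsmul R, hc J h, zero_smul, smul_zero]
  · rw [extProj_superMonomial R _ _ h]
    split_ifs with h'
    · rw [smul_comm]
    · simp

/-- Strong induction on `|J|`: once the smaller coefficients vanish in `R`, the part of degree `|J|`
shows the coefficient times `2^(|J|/2)`. The only use of the parity of the characteristic. -/
theorem coeff_eq_zero_of_extProj_eq_zero {l : ℕ} [CharP R l] (hl : Odd l ∨ l = 0)
    (c : {J : Finset (Fin n) // Even J.card} → ℤ) (N : ℕ)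
    (hN : ∀ k < N, Even k →
      extProj R k (∑ J, c J • superMonomial 1 (extGen R) (J : Finset (Fin n))) = 0)
    (J : {J : Finset (Fin n) // Even J.card}) (hJ : (J : Finset (Fin n)).card < N) :
    (c J : R) = 0 := by
  induction hk : (J : Finset (Fin n)).card using Nat.strong_induction_on generalizing J with
  | _ k ih =>
    have h1 := hN k (hk ▸ hJ) (hk ▸ J.2)
    rw [extProj_sum_superMonomial R c k fun J' hJ' => ih _ hJ' J' (by omega) rfl] at h1
    have h2 := congrArg (fun x => (Pi.basisFun R (Fin n)).ExteriorAlgebra.repr x J) h1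
    have h3 : ∀ J' : {J : Finset (Fin n) // Even J.card},
        (Pi.basisFun R (Fin n)).ExteriorAlgebra.repr (if (J' : Finset (Fin n)).card = k then
          c J' • (Pi.basisFun R (Fin n)).ExteriorAlgebra J' else 0) J =
          if J' = J then (c J : R) else 0 := by
      intro J'
      by_cases hJJ : J' = J
      · subst hJJ
        rw [if_pos hk, if_pos rfl, ← Int.cast_smul_eq_zsmul R]
        simp
      · rw [if_neg hJJ]
        split_ifs
        · rw [← Int.cast_smul_eq_zsmul R]
          simp [Subtype.coe_injective.ne hJJ]
        · simp
    rw [← Int.cast_smul_eq_zsmul R] at h2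
    simp only [map_smul, map_sum, Finsupp.smul_apply, Finsupp.finsetSum_apply, h3, map_zero,
      Finsupp.zero_apply, Finset.sum_ite_eq', Finset.mem_univ, if_true, smul_eq_mul] at h2
    rw [← Int.cast_mul, CharP.intCast_eq_zero_iff R l] at h2
    rw [CharP.intCast_eq_zero_iff R l]
    -- A power of 2 is coprime to odd `l`; for `l = 0` divisibility means equality to zero in `ℤ`.
    rcases hl with hl | rfl
    · refine IsCoprime.dvd_of_dvd_mul_left ?_ h2
      refine IsCoprime.pow_right ?_
      exact_mod_cast Nat.isCoprime_iff_coprime.2 (Nat.coprime_two_right.2 hl)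
    · simpa using h2

end Exterior

/-! ### The `ℤ Sₙ`-module structure on the exterior algebra and the hook filtration of `ℤ Sₙ` -/

section ExtModule

variable (n : ℕ)

/-- `Sₙ` acts on the exterior algebra of `ℤⁿ` by permuting the generators. -/
noncomputable def extRep : Representation ℤ (Equiv.Perm (Fin n)) (ExtAlg ℤ n) where
  toFun g := (ExteriorAlgebra.map (LinearMap.funLeft ℤ ℤ g.symm)).toLinearMap
  map_one' := by
    have : LinearMap.funLeft ℤ ℤ ((1 : Equiv.Perm (Fin n)).symm) = LinearMap.id := by
      ext; rfl
    rw [this, ExteriorAlgebra.map_id]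
    rfl
  map_mul' g h := by
    have : LinearMap.funLeft ℤ ℤ ((g * h : Equiv.Perm (Fin n)).symm) =
        LinearMap.funLeft ℤ ℤ g.symm ∘ₗ LinearMap.funLeft ℤ ℤ h.symm := rfl
    rw [this, ← ExteriorAlgebra.map_comp_map]
    rfl

variable {n}

theorem extRep_mul (g : Equiv.Perm (Fin n)) (x y : ExtAlg ℤ n) :
    extRep n g (x * y) = extRep n g x * extRep n g y :=
  map_mul (ExteriorAlgebra.map (LinearMap.funLeft ℤ ℤ g.symm)) x y

theorem extRep_one (g : Equiv.Perm (Fin n)) : extRep n g (1 : ExtAlg ℤ n) = 1 :=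
  map_one (ExteriorAlgebra.map (LinearMap.funLeft ℤ ℤ g.symm))

theorem extRep_gen (g : Equiv.Perm (Fin n)) (i : Fin n) :
    extRep n g (extGen ℤ i) = extGen ℤ (g i) := by
  refine (ExteriorAlgebra.map_apply_ι _ _).trans ?_
  rw [extGen]
  congr 1
  ext j
  simp [LinearMap.funLeft_apply, Pi.single_apply, Equiv.symm_apply_eq]

theorem extRep_extWord (g : Equiv.Perm (Fin n)) (w : List (Fin n)) :
    extRep n g (extWord ℤ w) = extWord ℤ (w.map g) := by
  induction w with
  | nil => exact extRep_one g
  | cons i w ih => rw [List.map_cons, extWord_cons, extWord_cons, extRep_mul, extRep_gen, ih]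

theorem extRep_prod (g : Equiv.Perm (Fin n)) (w : List (Fin n)) :
    extRep n g (w.map (1 + extGen ℤ)).prod = ((w.map g).map (1 + extGen ℤ)).prod := by
  induction w with
  | nil => exact extRep_one g
  | cons i w ih =>
    rw [List.map_cons, List.map_cons, List.map_cons, List.prod_cons, List.prod_cons, extRep_mul, ih]
    congr 1
    rw [Pi.add_apply, map_add, extRep_gen]
    congr 1
    exact extRep_one g

theorem extProj_extRep (k : ℕ) (g : Equiv.Perm (Fin n)) (x : ExtAlg ℤ n) :
    extProj ℤ k (extRep n g x) = extRep n g (extProj ℤ k x) := by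
  suffices h : extProj ℤ k ∘ₗ extRep n g = extRep n g ∘ₗ extProj ℤ k from LinearMap.congr_fun h x
  refine extAlg_linearMap_ext ℤ fun w => ?_
  rw [LinearMap.comp_apply, LinearMap.comp_apply, extRep_extWord, extProj_extWord, extProj_extWord,
    List.length_map]
  split_ifs
  · rw [extRep_extWord]
  · rw [map_zero]

theorem extContract_extRep (g : Equiv.Perm (Fin n)) (x : ExtAlg ℤ n) :
    extContract ℤ (extRep n g x) = extRep n g (extContract ℤ x) := by
  suffices h : extContract ℤ ∘ₗ extRep n g = extRep n g ∘ₗ extContract ℤ from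
    LinearMap.congr_fun h x
  refine extAlg_linearMap_ext ℤ fun w => ?_
  rw [LinearMap.comp_apply, LinearMap.comp_apply]
  induction w with
  | nil => simp [extWord, extRep_one, extContract_one]
  | cons i w ih =>
    rw [extWord_cons, extRep_mul, extRep_gen, extContract_gen_mul, ih, extContract_gen_mul, map_sub,
      extRep_mul, extRep_gen]

variable (n)

/-- The exterior algebra of `ℤⁿ` as a `ℤ Sₙ`-module. -/
abbrev ExtModule : Type := (extRep n).asModule

variable {n}

/-- An additive map commuting with the group elements is linear over the integral group ring. -/
noncomputable def linearMapOfCommSingle {G V W : Type*} [Group G] [AddCommGroup V]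
    [AddCommGroup W] [Module (MonoidAlgebra ℤ G) V] [Module (MonoidAlgebra ℤ G) W] (f : V →+ W)
    (hf : ∀ (g : G) (v : V), f (MonoidAlgebra.single g (1 : ℤ) • v) =
      MonoidAlgebra.single g (1 : ℤ) • f v) : V →ₗ[MonoidAlgebra ℤ G] W where
  __ := f
  map_smul' c v := by
    change f (c • v) = c • f v
    induction c using MonoidAlgebra.induction_linear with
    | zero => simp
    | add x y hx hy => rw [add_smul, add_smul, map_add, hx, hy]
    | single g c =>
      rw [show MonoidAlgebra.single g c = c • MonoidAlgebra.single g (1 : ℤ) by simp, smul_assoc,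
        smul_assoc, map_zsmul, hf]

theorem asModuleEquiv_single_one_smul (g : Equiv.Perm (Fin n)) (v : ExtModule n) :
    (extRep n).asModuleEquiv (MonoidAlgebra.single g (1 : ℤ) • v) =
      extRep n g ((extRep n).asModuleEquiv v) := by
  rw [Representation.asModuleEquiv_map_smul, Representation.asAlgebraHom_single_one]

/-- A linear endomorphism of the exterior algebra commuting with `Sₙ`, as a `ℤ Sₙ`-linear map. -/
noncomputable def extEquivariant (f : ExtAlg ℤ n →ₗ[ℤ] ExtAlg ℤ n)
    (hf : ∀ g x, f (extRep n g x) = extRep n g (f x)) :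
    ExtModule n →ₗ[IntSymGroupRing n] ExtModule n :=
  linearMapOfCommSingle
    ((extRep n).asModuleEquiv.symm.toLinearMap ∘ₗ f ∘ₗ
      (extRep n).asModuleEquiv.toLinearMap).toAddMonoidHom fun g v => by
    refine (extRep n).asModuleEquiv.injective ?_
    rw [asModuleEquiv_single_one_smul]
    change (extRep n).asModuleEquiv ((extRep n).asModuleEquiv.symm
      (f ((extRep n).asModuleEquiv (MonoidAlgebra.single g (1 : ℤ) • v)))) = _
    rw [asModuleEquiv_single_one_smul, hf]
    rfl

theorem asModuleEquiv_extEquivariant (f : ExtAlg ℤ n →ₗ[ℤ] ExtAlg ℤ n)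
    (hf : ∀ g x, f (extRep n g x) = extRep n g (f x)) (x : ExtModule n) :
    (extRep n).asModuleEquiv (extEquivariant f hf x) = f ((extRep n).asModuleEquiv x) := rfl

/-- The projection to degree `k` as a `ℤ Sₙ`-linear map. -/
noncomputable def extProjHom (k : ℕ) : ExtModule n →ₗ[IntSymGroupRing n] ExtModule n :=
  extEquivariant (extProj ℤ k) (extProj_extRep k)

/-- The contraction as a `ℤ Sₙ`-linear map. -/
noncomputable def extContractHom : ExtModule n →ₗ[IntSymGroupRing n] ExtModule n :=
  extEquivariant (extContract ℤ) extContract_extRep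

/-- Evaluation of multilinear polynomials at `x_i = 1 + e_i`. -/
noncomputable def evalExt : IntSymGroupRing n →ₗ[IntSymGroupRing n] ExtModule n :=
  LinearMap.toSpanSingleton _ (ExtModule n)
    ((extRep n).asModuleEquiv.symm ((List.finRange n).map (1 + extGen ℤ)).prod)

theorem asModuleEquiv_evalExt (f : IntSymGroupRing n) :
    (extRep n).asModuleEquiv (evalExt f) = evalWords (1 + extGen ℤ) f := by
  induction f using MonoidAlgebra.induction_linear with
  | zero => rw [map_zero, map_zero, map_zero]
  | add f g hf hg => rw [map_add, map_add, map_add, hf, hg]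
  | single σ c =>
    rw [evalWords_single, show MonoidAlgebra.single σ c = c • MonoidAlgebra.single σ (1 : ℤ) by simp,
      map_zsmul, map_zsmul, evalExt, LinearMap.toSpanSingleton_apply, asModuleEquiv_single_one_smul,
      LinearEquiv.apply_symm_apply, extRep_prod, List.map_map, List.ofFn_eq_map]
    rfl

/-- The maps whose successive kernels define the hook filtration. -/
noncomputable def hookMap (k : ℕ) : IntSymGroupRing n →ₗ[IntSymGroupRing n] ExtModule n :=
  -- Only even degrees carry leading terms. An even degree `d > 0` is used twice: index `d - 1` sees
  -- the contraction of that part, and index `d` sees the part itself, by then a cycle.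
  if Even k then extProjHom k ∘ₗ evalExt else extContractHom ∘ₗ extProjHom (k + 1) ∘ₗ evalExt

theorem hookMap_of_even {k : ℕ} (hk : Even k) (f : IntSymGroupRing n) :
    (extRep n).asModuleEquiv (hookMap k f) = extProj ℤ k (evalWords (1 + extGen ℤ) f) := by
  rw [hookMap, if_pos hk, ← asModuleEquiv_evalExt]
  rfl

theorem hookMap_of_odd {k : ℕ} (hk : ¬ Even k) (f : IntSymGroupRing n) :
    (extRep n).asModuleEquiv (hookMap k f) =
      extContract ℤ (extProj ℤ (k + 1) (evalWords (1 + extGen ℤ) f)) := by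
  rw [hookMap, if_neg hk, ← asModuleEquiv_evalExt]
  rfl

variable (n) in
/-- The hook filtration of `ℤ Sₙ`. -/
noncomputable def hookFiltration (k : ℕ) : Submodule (IntSymGroupRing n) (IntSymGroupRing n) :=
  ⨅ j, ⨅ _ : j < k, LinearMap.ker (hookMap j)

theorem mem_hookFiltration {k : ℕ} {f : IntSymGroupRing n} :
    f ∈ hookFiltration n k ↔ ∀ j < k, hookMap j f = 0 := by
  simp [hookFiltration, Submodule.mem_iInf]

theorem mem_hookFiltration_succ {k : ℕ} {f : IntSymGroupRing n} :
    f ∈ hookFiltration n (k + 1) ↔ f ∈ hookFiltration n k ∧ hookMap k f = 0 := by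
  simp only [mem_hookFiltration]
  exact Nat.forall_lt_succ_right

theorem hookFiltration_antitone : Antitone (hookFiltration n) := fun _ _ hjk _ hf =>
  mem_hookFiltration.2 fun i hi => mem_hookFiltration.1 hf i (hi.trans_le hjk)

variable (n) in
/-- The cycles (equivalently boundaries) of degree `k` of the contraction. -/
noncomputable def extBoundaries (k : ℕ) : Submodule (IntSymGroupRing n) (ExtModule n) :=
  LinearMap.range (extContractHom ∘ₗ extProjHom (k + 1))

theorem mem_extBoundaries {k : ℕ} {z : ExtModule n} :
    z ∈ extBoundaries n k ↔
      ∃ y : ExtAlg ℤ n, extContract ℤ (extProj ℤ (k + 1) y) = (extRep n).asModuleEquiv z :=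
  Iff.rfl

theorem mem_extBoundaries_of_contract_eq_zero (hn : 1 ≤ n) {k : ℕ} {z : ExtAlg ℤ n}
    (hz : extProj ℤ k z = z) (hd : extContract ℤ z = 0) :
    (extRep n).asModuleEquiv.symm z ∈ extBoundaries n k := by
  refine mem_extBoundaries.2 ⟨extGen ℤ ⟨0, hn⟩ * z, ?_⟩
  rw [extProj_gen_mul, hz, ← eq_extContract_of_extContract_eq_zero ℤ _ hd,
    LinearEquiv.apply_symm_apply]

theorem extAlg_zsmul_eq_zero {c : ℤ} (hc : c ≠ 0) {x : ExtAlg ℤ n} (hx : c • x = 0) : x = 0 := by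
  refine (Pi.basisFun ℤ (Fin n)).ExteriorAlgebra.repr.map_eq_zero_iff.1 (Finsupp.ext fun J => ?_)
  have := congrArg (Pi.basisFun ℤ (Fin n)).ExteriorAlgebra.repr hx
  rw [map_zsmul, map_zero] at this
  simpa [hc] using DFunLike.congr_fun this J

theorem extModule_zsmul_eq_zero {c : ℤ} (hc : c ≠ 0) {x : ExtModule n} (hx : c • x = 0) :
    x = 0 := by
  refine (extRep n).asModuleEquiv.injective ?_
  rw [map_zero]
  refine extAlg_zsmul_eq_zero hc ?_
  rw [← map_zsmul, hx, map_zero]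

theorem exists_coeff_evalWords_one_add (f : IntSymGroupRing n) :
    ∃ c : {J : Finset (Fin n) // Even J.card} → ℤ,
      evalWords (1 + extGen ℤ) f = ∑ J, c J • superMonomial 1 (extGen ℤ) (J : Finset (Fin n)) :=
  evalWords_mem_span_superMonomial (extGen_isSupercommuting ℤ) f

/-- Vanishing in lower even degrees kills the coefficients of smaller `J`, so degree `N` contains
only leading terms, all divisible by `2^(N/2)`. -/
theorem extProj_evalWords_eq_two_pow_smul {N : ℕ} {f : IntSymGroupRing n}
    (hf : ∀ j < N, Even j → extProj ℤ j (evalWords (1 + extGen ℤ) f) = 0) :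
    ∃ y : ExtAlg ℤ n, extProj ℤ N y = y ∧
      extProj ℤ N (evalWords (1 + extGen ℤ) f) = (2 ^ (N / 2) : ℤ) • y := by
  obtain ⟨c, hc⟩ := exists_coeff_evalWords_one_add f
  rw [hc] at hf ⊢
  refine ⟨_, ?_, extProj_sum_superMonomial ℤ c N fun J hJ =>
    coeff_eq_zero_of_extProj_eq_zero ℤ (Or.inr rfl : Odd 0 ∨ 0 = 0) c N hf J hJ⟩
  rw [map_sum]
  refine Finset.sum_congr rfl fun J _ => ?_
  split_ifs with h
  · rw [map_zsmul, extBasis_apply, extProj_extWord, if_pos (by simpa using h)]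
  · rw [map_zero]

/-- Every leading term allowed by the divisibility occurs: combine polynomials representing the
standard monomials, with the coordinates of `y` as coefficients. -/
theorem exists_extProj_evalWords_eq {N : ℕ} (hN : Even N) {y : ExtAlg ℤ n}
    (hy : extProj ℤ N y = y) :
    ∃ f : IntSymGroupRing n, (∀ j < N, extProj ℤ j (evalWords (1 + extGen ℤ) f) = 0) ∧
      extProj ℤ N (evalWords (1 + extGen ℤ) f) = (2 ^ (N / 2) : ℤ) • y := by
  choose β hβ using fun J : {J : Finset (Fin n) // Even J.card} =>
    exists_evalWords_eq_superMonomial (extGen_isSupercommuting ℤ) (J : Finset (Fin n)) J.2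
  let B := (Pi.basisFun ℤ (Fin n)).ExteriorAlgebra
  let c : {J : Finset (Fin n) // Even J.card} → ℤ := fun J =>
    if (J : Finset (Fin n)).card = N then B.repr y J else 0
  have hc : ∀ J : {J : Finset (Fin n) // Even J.card}, (J : Finset (Fin n)).card < N →
      ((c J : ℤ) : ℤ) = 0 := fun J hJ => if_neg hJ.ne
  have hval : evalWords (1 + extGen ℤ) (∑ J, c J • β J) =
      ∑ J, c J • superMonomial 1 (extGen ℤ) (J : Finset (Fin n)) := by
    rw [map_sum]
    exact Finset.sum_congr rfl fun J _ => by rw [map_zsmul, hβ]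
  refine ⟨∑ J, c J • β J, fun j hj => ?_, ?_⟩
  · rw [hval, extProj_sum_superMonomial ℤ c j fun J hJ => hc J (hJ.trans hj)]
    rw [Finset.sum_eq_zero, smul_zero]
    intro J _
    split_ifs with h
    · have : c J = 0 := hc J (h ▸ hj)
      rw [this, zero_smul]
    · rfl
  · rw [hval, extProj_sum_superMonomial ℤ c N hc]
    congr 1
    conv_rhs => rw [← hy, ← B.sum_repr y, map_sum]
    refine Fintype.sum_of_injective Subtype.val Subtype.val_injective _ _ ?_ ?_
    · intro J hJ
      rw [map_smul, extBasis_apply, extProj_extWord, if_neg, smul_zero]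
      rw [Finset.length_sort]
      rintro rfl
      exact hJ ⟨⟨J, hN⟩, rfl⟩
    · intro J
      rw [map_smul, extBasis_apply, extProj_extWord, Finset.length_sort]
      split_ifs with h
      · simp only [c, if_pos h]
      · rw [smul_zero]

theorem extProj_evalWords_eq_zero_of_mem {k : ℕ} {f : IntSymGroupRing n}
    (hf : f ∈ hookFiltration n k) {j : ℕ} (hj : Even j) (hjk : j < k) :
    extProj ℤ j (evalWords (1 + extGen ℤ) f) = 0 := by
  rw [← hookMap_of_even hj, mem_hookFiltration.1 hf j hjk, map_zero]

/-- On the `k`-th step of the filtration `hookMap k` is divisible by `2 ^ ⌈k / 2⌉`, with quotient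
in the boundaries. -/
theorem hookMap_eq_two_pow_smul (hn : 1 ≤ n) {k : ℕ} {f : IntSymGroupRing n}
    (hf : f ∈ hookFiltration n k) :
    ∃ z ∈ extBoundaries n k, hookMap k f = (2 ^ ((k + 1) / 2) : ℤ) • z := by
  by_cases hk : Even k
  · have hk' : (k + 1) / 2 = k / 2 := by
      obtain ⟨m, rfl⟩ := hk
      omega
    obtain ⟨y, hy, hfy⟩ := extProj_evalWords_eq_two_pow_smul (N := k)
      fun j hj he => extProj_evalWords_eq_zero_of_mem hf he hj
    -- The preceding odd index `k - 1` already killed the contraction of the degree `k` part; degree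
    -- 0 is killed anyway.
    have hd : extContract ℤ (extProj ℤ k (evalWords (1 + extGen ℤ) f)) = 0 := by
      rcases k with _ | k
      · exact extContract_extProj_zero ℤ _
      · have := mem_hookFiltration.1 hf k (by omega)
        rw [← hookMap_of_odd (by simpa [Nat.even_add_one] using hk), this, map_zero]
    rw [hfy, map_zsmul] at hd
    refine ⟨_, mem_extBoundaries_of_contract_eq_zero hn hy 
      (extAlg_zsmul_eq_zero (by positivity) hd), ?_⟩
    refine (extRep n).asModuleEquiv.injective ?_
    rw [hookMap_of_even hk, hfy, map_zsmul, LinearEquiv.apply_symm_apply]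
    rw [hk']
  -- For odd `k` the relevant part has degree `k + 1`; an even `j < k + 1` is automatically below
  -- `k`.
  · obtain ⟨y, hy, hfy⟩ := extProj_evalWords_eq_two_pow_smul (N := k + 1) (f := f)
      fun j hj he => extProj_evalWords_eq_zero_of_mem hf he
        (lt_of_le_of_ne (by omega) (by rintro rfl; exact hk he))
    refine ⟨(extRep n).asModuleEquiv.symm (extContract ℤ y), mem_extBoundaries.2 ⟨y, ?_⟩, ?_⟩
    · rw [hy, LinearEquiv.apply_symm_apply]
    · refine (extRep n).asModuleEquiv.injective ?_
      rw [hookMap_of_odd hk, hfy, map_zsmul, map_zsmul, LinearEquiv.apply_symm_apply]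

/-- Lift a leading term: `z` itself when `k` is even, a preimage of `z` under the contraction when
`k` is odd. -/
theorem exists_hookMap_eq_two_pow_smul {k : ℕ} {z : ExtModule n} (hz : z ∈ extBoundaries n k) :
    ∃ f ∈ hookFiltration n k, hookMap k f = (2 ^ ((k + 1) / 2) : ℤ) • z := by
  obtain ⟨y, hy⟩ := mem_extBoundaries.1 hz
  by_cases hk : Even k
  · have hk' : (k + 1) / 2 = k / 2 := by
      obtain ⟨m, rfl⟩ := hk
      omega
    obtain ⟨f, hf, hfz⟩ := exists_extProj_evalWords_eq hk
      (y := (extRep n).asModuleEquiv z) (by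
        rw [← hy, extProj_extContract, extProj_extProj])
    refine ⟨f, mem_hookFiltration.2 fun j hj => ?_, ?_⟩
    · refine (extRep n).asModuleEquiv.injective ?_
      rw [map_zero]
      by_cases hj' : Even j
      · rw [hookMap_of_even hj', hf j hj]
      · rw [hookMap_of_odd hj']
        -- For `j + 1 = k` the degree `k` part is not zero, but it is a multiple of a boundary, so
        -- its contraction vanishes.
        rcases lt_or_eq_of_le (Nat.succ_le_of_lt hj) with h | h
        · rw [hf _ h, map_zero]
        · rw [Nat.succ_eq_add_one] at h
          rw [h, hfz, ← hy, map_zsmul, extContract_extContract, smul_zero]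
    · refine (extRep n).asModuleEquiv.injective ?_
      rw [hookMap_of_even hk, hfz, map_zsmul]
      rw [hk']
  · obtain ⟨f, hf, hfz⟩ := exists_extProj_evalWords_eq (N := k + 1) (Nat.even_add_one.2 hk)
      (extProj_extProj ℤ (k + 1) y)
    refine ⟨f, mem_hookFiltration.2 fun j hj => ?_, ?_⟩
    · refine (extRep n).asModuleEquiv.injective ?_
      rw [map_zero]
      by_cases hj' : Even j
      · rw [hookMap_of_even hj', hf j (by omega)]
      · rw [hookMap_of_odd hj', hf _ (by omega), map_zero]
    · refine (extRep n).asModuleEquiv.injective ?_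
      rw [hookMap_of_odd hk, hfz, map_zsmul, map_zsmul, hy]

/-- The last step of the filtration consists of the polynomials vanishing at `1 + e_i` over `ℤ`,
whatever expansion is chosen. -/
theorem mem_hookFiltration_self_iff (hn : 1 ≤ n) {f : IntSymGroupRing n}
    {c : {J : Finset (Fin n) // Even J.card} → ℤ}
    (hc : evalWords (1 + extGen ℤ) f =
      ∑ J, c J • superMonomial 1 (extGen ℤ) (J : Finset (Fin n))) :
    f ∈ hookFiltration n n ↔ c = 0 := by
  constructor
  · intro hf
    have h0 : ∀ k < n + 1, Even k → extProj ℤ k (evalWords (1 + extGen ℤ) f) = 0 := by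
      intro k hk he
      rcases Nat.lt_succ_iff_lt_or_eq.1 hk with h | rfl
      · exact extProj_evalWords_eq_zero_of_mem hf he h
      -- In top degree only the contraction is controlled. A cycle there is the contraction of
      -- something in degree `n + 1`, hence zero.
      · obtain ⟨m, rfl⟩ : ∃ m, k = m + 1 := ⟨k - 1, by omega⟩
        have h1 := mem_hookFiltration.1 hf m (by omega)
        have h2 := hookMap_of_odd (n := m + 1) (k := m) (by simpa [Nat.even_add_one] using he) f
        rw [h1, map_zero] at h2
        rw [← extProj_extProj,
          eq_extContract_of_extContract_eq_zero ℤ (0 : Fin (m + 1)) h2.symm, extProj_extContract,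
          extProj_eq_zero_of_lt ℤ (by omega), map_zero]
    rw [hc] at h0
    funext J
    refine coeff_eq_zero_of_extProj_eq_zero ℤ (Or.inr rfl : Odd 0 ∨ 0 = 0) c (n + 1) h0 J ?_
    have := Finset.card_le_univ (J : Finset (Fin n))
    rw [Fintype.card_fin] at this
    omega
  · rintro rfl
    have h0 : evalWords (1 + extGen ℤ) f = 0 := by
      rw [hc]
      simp
    refine mem_hookFiltration.2 fun j _ => (extRep n).asModuleEquiv.injective ?_
    rw [map_zero]
    by_cases hj : Even j
    · rw [hookMap_of_even hj, h0, map_zero]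
    · rw [hookMap_of_odd hj, h0, map_zero, map_zero]

end ExtModule

/-! ### The Grassmann algebra -/

section Anticommuting

variable (R : Type*) {G : Type*} [CommRing R] [Ring G] [Algebra R G] {γ : ℕ → G}

theorem mul_list_prod_of_anticommute (hγ : ∀ i j, γ i * γ j = -(γ j * γ i)) (i : ℕ)
    (w : List ℕ) :
    γ i * (w.map γ).prod = ((-1) ^ w.length : ℤ) • ((w.map γ).prod * γ i) := by
  induction w with
  | nil => simp
  | cons j w ih =>
    rw [List.map_cons, List.prod_cons, ← mul_assoc, hγ, neg_mul, mul_assoc, ih, mul_smul_comm,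
      List.length_cons, pow_succ, mul_neg_one, neg_smul, mul_assoc]

theorem list_prod_mul_list_prod_of_anticommute (hγ : ∀ i j, γ i * γ j = -(γ j * γ i))
    (v w : List ℕ) :
    (v.map γ).prod * (w.map γ).prod =
      ((-1) ^ (v.length * w.length) : ℤ) • ((w.map γ).prod * (v.map γ).prod) := by
  induction v with
  | nil => simp
  | cons i v ih =>
    rw [List.map_cons, List.prod_cons, mul_assoc, ih, mul_smul_comm, ← mul_assoc,
      mul_list_prod_of_anticommute hγ, smul_mul_assoc, smul_smul, ← pow_add, List.length_cons,
      mul_assoc, add_mul, one_mul]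

variable (γ) in
/-- The span of the even (`p = 0`) or odd (`p = 1`) products of the `γ i`. -/
def parityPart (p : ZMod 2) : Submodule R G :=
  Submodule.span R {x | ∃ w : List ℕ, (w.length : ZMod 2) = p ∧ x = (w.map γ).prod}

/-- The sign `ε` depends only on the parities of the lengths, so bilinearity reduces the claim to
products of generators. -/
theorem parityPart_mul_comm (hγ : ∀ i j, γ i * γ j = -(γ j * γ i)) {p q : ZMod 2} (ε : ℤ)
    (hε : ∀ a b : ℕ, (a : ZMod 2) = p → (b : ZMod 2) = q → (-1 : ℤ) ^ (a * b) = ε)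
    {x y : G} (hx : x ∈ parityPart R γ p) (hy : y ∈ parityPart R γ q) :
    x * y = ε • (y * x) := by
  induction hx, hy using Submodule.span_induction₂ with
  | mem_mem x y hx hy =>
    obtain ⟨v, hv, rfl⟩ := hx
    obtain ⟨w, hw, rfl⟩ := hy
    rw [list_prod_mul_list_prod_of_anticommute hγ, hε _ _ hv hw]
  | zero_left => simp
  | zero_right => simp
  | add_left x y z _ _ _ h1 h2 => rw [add_mul, h1, h2, mul_add, smul_add]
  | add_right x y z _ _ _ h1 h2 => rw [mul_add, h1, h2, add_mul, smul_add]
  | smul_left r x y _ _ h => rw [smul_mul_assoc, h, mul_smul_comm, smul_comm]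
  | smul_right r x y _ _ h => rw [smul_mul_assoc, mul_smul_comm, h, smul_comm]

theorem parityPart_mul_mem {p q : ZMod 2} {x y : G} (hx : x ∈ parityPart R γ p)
    (hy : y ∈ parityPart R γ q) : x * y ∈ parityPart R γ (p + q) := by
  induction hx, hy using Submodule.span_induction₂ with
  | mem_mem x y hx hy =>
    obtain ⟨v, hv, rfl⟩ := hx
    obtain ⟨w, hw, rfl⟩ := hy
    refine Submodule.subset_span ⟨v ++ w, ?_, by simp⟩
    rw [List.length_append, Nat.cast_add, hv, hw]
  | zero_left => simp
  | zero_right => simp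
  | add_left x y z _ _ _ h1 h2 => rw [add_mul]; exact add_mem h1 h2
  | add_right x y z _ _ _ h1 h2 => rw [mul_add]; exact add_mem h1 h2
  | smul_left r x y _ _ h => rw [smul_mul_assoc]; exact Submodule.smul_mem _ _ h
  | smul_right r x y _ _ h => rw [mul_smul_comm]; exact Submodule.smul_mem _ _ h

/-- Only existence of the decomposition is needed; the sum of the two parts need not be direct. -/
theorem exists_parity_decomposition (φ : FreeAlgebra R ℕ →ₐ[R] G)
    (hφ : ∀ i, φ (FreeAlgebra.ι R i) = γ i) (x : FreeAlgebra R ℕ) :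
    ∃ a b, a ∈ parityPart R γ 0 ∧ b ∈ parityPart R γ 1 ∧ φ x = a + b := by
  induction x using FreeAlgebra.induction with
  | grade0 r =>
    refine ⟨r • 1, 0, Submodule.smul_mem _ _ (Submodule.subset_span ⟨[], by simp, rfl⟩),
      zero_mem _, ?_⟩
    rw [AlgHom.commutes, Algebra.algebraMap_eq_smul_one, add_zero]
  | grade1 i =>
    refine ⟨0, γ i, zero_mem _, Submodule.subset_span ⟨[i], by simp, by simp⟩, ?_⟩
    rw [zero_add, hφ]
  | mul x y hx hy =>
    obtain ⟨a, b, ha, hb, hx⟩ := hx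
    obtain ⟨c, d, hc, hd, hy⟩ := hy
    refine ⟨a * c + b * d, a * d + b * c, ?_, ?_, ?_⟩
    · exact add_mem (by simpa using parityPart_mul_mem R ha hc)
        (by simpa [CharTwo.add_self_eq_zero] using parityPart_mul_mem R hb hd)
    · exact add_mem (by simpa using parityPart_mul_mem R ha hd)
        (by simpa using parityPart_mul_mem R hb hc)
    · rw [map_mul, hx, hy, add_mul, mul_add, mul_add]
      abel
  | add x y hx hy =>
    obtain ⟨a, b, ha, hb, hx⟩ := hx
    obtain ⟨c, d, hc, hd, hy⟩ := hy
    refine ⟨a + c, b + d, add_mem ha hc, add_mem hb hd, ?_⟩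
    rw [map_add, hx, hy]
    abel

theorem parityPart_isSupercommuting (hγ : ∀ i j, γ i * γ j = -(γ j * γ i)) {ι : Type*}
    {a b : ι → G} (ha : ∀ i, a i ∈ parityPart R γ 0) (hb : ∀ i, b i ∈ parityPart R γ 1) :
    IsSupercommuting a b where
  even_even i j := by
    refine (parityPart_mul_comm R hγ 1 (fun m k hm _ => ?_) (ha i) (ha j)).trans (one_smul _ _)
    exact ((ZMod.natCast_eq_zero_iff_even.1 hm).mul_right k).neg_one_pow
  even_odd i j := by
    refine (parityPart_mul_comm R hγ 1 (fun m k hm _ => ?_) (ha i) (hb j)).trans (one_smul _ _)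
    exact ((ZMod.natCast_eq_zero_iff_even.1 hm).mul_right k).neg_one_pow
  odd_odd i j := by
    refine (parityPart_mul_comm R hγ (-1) (fun m k hm hk => ?_) (hb i) (hb j)).trans (by simp)
    exact ((ZMod.natCast_eq_one_iff_odd.1 hm).mul (ZMod.natCast_eq_one_iff_odd.1 hk)).neg_one_pow

end Anticommuting

section Grassmann

variable (R : Type*) [CommRing R]

/-- The generators `e_i` of the Grassmann algebra. -/
noncomputable def grassmannGen (i : ℕ) : GrassmannAlgebra R :=
  RingQuot.mkAlgHom R (GrassmannRel R) (FreeAlgebra.ι R i)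

theorem grassmannGen_mul (i j : ℕ) :
    grassmannGen R i * grassmannGen R j = -(grassmannGen R j * grassmannGen R i) := by
  have := RingQuot.mkAlgHom_rel R (GrassmannRel.anticomm (R := R) i j)
  rw [map_mul] at this
  refine this.trans ((map_neg (RingQuot.mkAlgHom R (GrassmannRel R)) _).trans ?_)
  exact congrArg _ (map_mul (RingQuot.mkAlgHom R (GrassmannRel R)) _ _)

theorem exists_grassmann_decomposition (x : GrassmannAlgebra R) :
    ∃ a b, a ∈ parityPart R (grassmannGen R) 0 ∧ b ∈ parityPart R (grassmannGen R) 1 ∧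
      x = a + b := by
  obtain ⟨y, rfl⟩ := RingQuot.mkAlgHom_surjective R (GrassmannRel R) x
  exact exists_parity_decomposition R (RingQuot.mkAlgHom R (GrassmannRel R)) (fun _ => rfl) y

/-- The Grassmann algebra maps onto the exterior algebra of `Rⁿ`. -/
noncomputable def grassmannToExt (n : ℕ) : GrassmannAlgebra R →ₐ[R] ExtAlg R n :=
  RingQuot.liftAlgHom R ⟨FreeAlgebra.lift R fun i => if h : i < n then extGen R ⟨i, h⟩ else 0, by
    rintro _ _ ⟨i, j⟩
    rw [map_neg, map_mul, map_mul, FreeAlgebra.lift_ι_apply, FreeAlgebra.lift_ι_apply]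
    split_ifs
    · exact (extGen_isSupercommuting R).odd_odd _ _
    all_goals simp⟩

theorem grassmannToExt_gen {n : ℕ} (i : Fin n) :
    grassmannToExt R n (grassmannGen R i) = extGen R i := by
  simp [grassmannToExt, grassmannGen, RingQuot.liftAlgHom_mkAlgHom_apply]

end Grassmann

/-! ### Identities of the Grassmann algebra inside `ℤ Sₙ` -/

section Identities

theorem IsSupercommuting.prodMk {ι A B : Type*} [Ring A] [Ring B] {a b : ι → A} {c d : ι → B}
    (h : IsSupercommuting a b) (h' : IsSupercommuting c d) :
    IsSupercommuting (fun i => (a i, c i)) fun i => (b i, d i) where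
  even_even i j := Prod.ext (h.even_even i j) (h'.even_even i j)
  even_odd i j := Prod.ext (h.even_odd i j) (h'.even_odd i j)
  odd_odd i j := Prod.ext (h.odd_odd i j) (h'.odd_odd i j)

theorem IsSupercommuting.pi {ι K A : Type*} [Ring A] {a b : K → ι → A}
    (h : ∀ k, IsSupercommuting (a k) (b k)) :
    IsSupercommuting (fun i k => a k i) fun i k => b k i where
  even_even i j := funext fun k => (h k).even_even i j
  even_odd i j := funext fun k => (h k).even_odd i j
  odd_odd i j := funext fun k => (h k).odd_odd i j

theorem map_superMonomial {ι A B : Type*} [LinearOrder ι] [Fintype ι] [Ring A] [Ring B]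
    (φ : A →+* B) (a b : ι → A) (J : Finset ι) :
    φ (superMonomial a b J) = superMonomial (φ ∘ a) (φ ∘ b) J := by
  have : φ ∘ (a + b) = φ ∘ a + φ ∘ b := by ext; simp
  rw [superMonomial, superMonomial, superWord, superWord, map_zsmul, map_mul, map_list_prod,
    map_list_prod, List.map_map, List.map_map, this]

variable {R : Type*} [CommRing R] {n : ℕ}

/-- A multilinear polynomial takes the same integral combination of standard monomials in the
exterior algebras over `ℤ` and `R` and in the Grassmann algebra. -/
theorem exists_common_coeff (f : IntSymGroupRing n) (a b : (Fin n → GrassmannAlgebra R) → Fin n →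
      GrassmannAlgebra R) (hab : ∀ v, IsSupercommuting (a v) (b v)) (hv : ∀ v, v = a v + b v) :
    ∃ c : {J : Finset (Fin n) // Even J.card} → ℤ,
      evalWords (1 + extGen ℤ) f = ∑ J, c J • superMonomial 1 (extGen ℤ) (J : Finset (Fin n)) ∧
      evalWords (1 + extGen R) f = ∑ J, c J • superMonomial 1 (extGen R) (J : Finset (Fin n)) ∧
      ∀ v, evalWords v f = ∑ J, c J • superMonomial (a v) (b v) (J : Finset (Fin n)) := by
  -- One expansion in the product of both exterior algebras and one copy of the Grassmann algebra
  -- per assignment `v` makes the coefficients common to all of them.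
  have h := ((extGen_isSupercommuting (n := n) ℤ).prodMk (extGen_isSupercommuting R)).prodMk
    (IsSupercommuting.pi hab)
  obtain ⟨c, hc⟩ := evalWords_mem_span_superMonomial h f
  refine ⟨c, ?_, ?_, fun v => ?_⟩
  · have := congrArg ((RingHom.fst _ _).comp (RingHom.fst _ _)) hc
    simp only [map_evalWords, map_sum, map_zsmul, map_superMonomial] at this
    exact this
  · have := congrArg ((RingHom.snd _ _).comp (RingHom.fst _ _)) hc
    simp only [map_evalWords, map_sum, map_zsmul, map_superMonomial] at this
    exact this
  · have := congrArg ((Pi.evalRingHom _ v).comp (RingHom.snd _ _)) hc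
    simp only [map_evalWords, map_sum, map_zsmul, map_superMonomial] at this
    conv_lhs => rw [hv v]
    exact this

/-- Computes the kernel of `ℤ Sₙ` acting as functions on the Grassmann algebra. An identity has all
coefficients divisible by `l`; conversely coefficients zero and multiples of `l` give zero. -/
theorem forall_evalWords_eq_zero_iff {l : ℕ} [CharP R l] (hl : Odd l ∨ l = 0) (hn : 1 ≤ n)
    (f : IntSymGroupRing n) :
    (∀ v : Fin n → GrassmannAlgebra R, evalWords v f = 0) ↔
      ∃ h ∈ hookFiltration n n, ∃ y, f = h + l • y := by
  choose a b ha hb hab using exists_grassmann_decomposition R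
  constructor
  · intro hf
    obtain ⟨c, hc, hcR, -⟩ := exists_common_coeff f (fun v i => a (v i)) (fun v i => b (v i))
      (fun v => parityPart_isSupercommuting R (grassmannGen_mul R) (fun i => ha _) (fun i => hb _))
      (fun v => funext fun i => hab _)
    have h0 : evalWords (1 + extGen R) f = 0 := by
      have := congrArg (grassmannToExt R n).toRingHom (hf fun i => 1 + grassmannGen R i)
      rw [map_evalWords, map_zero] at this
      rw [← this]
      congr 1
      congr 1
      funext i
      simp [grassmannToExt_gen]
    have hdvd : ∀ J, ∃ c', c J = (l : ℤ) * c' := fun J => by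
      refine (CharP.intCast_eq_zero_iff R l _).1 ?_
      refine coeff_eq_zero_of_extProj_eq_zero R hl c ((J : Finset (Fin n)).card + 1)
        (fun k _ _ => ?_) J (Nat.lt_succ_self _)
      rw [← hcR, h0, map_zero]
    choose c' hc' using hdvd
    choose β hβ using fun J : {J : Finset (Fin n) // Even J.card} =>
      exists_evalWords_eq_superMonomial (extGen_isSupercommuting ℤ) (J : Finset (Fin n)) J.2
    -- `β J` represents the standard monomial of `J`, so this subtraction removes the whole value at
    -- `1 + e_i` over `ℤ`.
    refine ⟨f - l • ∑ J, c' J • β J, ?_, ∑ J, c' J • β J, by abel⟩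
    refine (mem_hookFiltration_self_iff hn (c := 0) ?_).2 rfl
    rw [map_sub, map_nsmul, map_sum, hc]
    simp only [map_zsmul, hβ, hc', mul_smul, Finset.smul_sum, natCast_zsmul, sub_self, Pi.zero_apply,
      zero_smul, Finset.sum_const_zero]
  · rintro ⟨h, hh, y, rfl⟩ v
    obtain ⟨c, hc, -, hcG⟩ := exists_common_coeff h (fun v i => a (v i)) (fun v i => b (v i))
      (fun v => parityPart_isSupercommuting R (grassmannGen_mul R) (fun i => ha _) (fun i => hb _))
      (fun v => funext fun i => hab _)
    have hc0 := (mem_hookFiltration_self_iff hn hc).1 hh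
    rw [map_add, map_nsmul, hcG, hc0, ← Nat.cast_smul_eq_nsmul R, CharP.cast_eq_zero, zero_smul]
    simp

end Identities

/-! ### Multilinear functions as a cyclic `ℤ Sₙ`-module -/

section MultilinearFunctions

variable {n : ℕ} (hn : 1 ≤ n)

/-- The monomial `x_{σ 0} ⋯ x_{σ (n - 1)}`. -/
def multilinearWord (hn : 1 ≤ n) (σ : Equiv.Perm (Fin n)) : FreeSemigroup ℕ :=
  ⟨σ ⟨0, hn⟩, (List.ofFn fun i => (σ i : ℕ)).tail⟩

theorem head_cons_tail_multilinearWord (σ : Equiv.Perm (Fin n)) :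
    (multilinearWord hn σ).head :: (multilinearWord hn σ).tail =
      List.ofFn fun i => (σ i : ℕ) := by
  obtain ⟨m, rfl⟩ : ∃ m, n = m + 1 := ⟨n - 1, by omega⟩
  simp [multilinearWord, List.ofFn_succ]

theorem eq_multilinearWord {σ : Equiv.Perm (Fin n)} {w : FreeSemigroup ℕ}
    (hw : w.head :: w.tail = List.ofFn fun i => (σ i : ℕ)) : w = multilinearWord hn σ := by
  rw [← head_cons_tail_multilinearWord hn, List.cons.injEq] at hw
  exact FreeSemigroup.ext hw.1 hw.2

theorem map_multilinearWord (σ τ : Equiv.Perm (Fin n)) :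
    FreeSemigroup.map (permNat n σ) (multilinearWord hn τ) = multilinearWord hn (σ * τ) := by
  refine eq_multilinearWord hn ?_
  rw [freeSemigroup_map_eq]
  change List.map (permNat n σ) ((multilinearWord hn τ).head :: (multilinearWord hn τ).tail) = _
  rw [head_cons_tail_multilinearWord, List.map_ofFn]
  simp [Function.comp_def, permNat_apply]

theorem map_single_word {A : Type*} [Ring A] (ψ : FreeRngInt →ₙ+* A) (w : FreeSemigroup ℕ) :
    ψ (MonoidAlgebra.single w 1) = ((w.head :: w.tail).map fun i =>
      ψ (MonoidAlgebra.single (FreeSemigroup.of i) 1)).prod := by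
  induction w using FreeSemigroup.recOnMul with
  | ih1 x => simp [FreeSemigroup.of]
  | ih2 x y hx hy =>
    have : (MonoidAlgebra.single (FreeSemigroup.of x * y) 1 : FreeRngInt) =
      MonoidAlgebra.single (FreeSemigroup.of x) 1 * MonoidAlgebra.single y 1 := by
      rw [MonoidAlgebra.single_mul_single, one_mul]
    rw [this, map_mul, hy, hx]
    simp

theorem exists_hom_of_values {A : Type*} [Ring A] (v : ℕ → A) :
    ∃ ψ : FreeRngInt →ₙ+* A, ∀ i, ψ (MonoidAlgebra.single (FreeSemigroup.of i) 1) = v i := by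
  refine ⟨(MonoidAlgebra.liftMagma ℤ (FreeSemigroup.lift v) : FreeRngInt →ₙ+* A), fun i => ?_⟩
  have := (MonoidAlgebra.liftMagma ℤ).symm_apply_apply (FreeSemigroup.lift v)
  exact (DFunLike.congr_fun this (FreeSemigroup.of i)).trans (FreeSemigroup.lift_of v i)

/-- The monomial `x_0 ⋯ x_{n - 1}`. -/
noncomputable def standardMonomial : multilinearPolys n :=
  ⟨(MonoidAlgebra.single (multilinearWord hn 1) 1 : FreeRngInt),
    show (MonoidAlgebra.single (multilinearWord hn 1) 1 : FreeRngInt) ∈ multilinearSpan n from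
      Submodule.subset_span
        ⟨1, multilinearWord hn 1, head_cons_tail_multilinearWord hn 1, rfl⟩⟩

theorem single_smul_standardMonomial (σ : Equiv.Perm (Fin n)) :
    (permVars n).asModuleEquiv (MonoidAlgebra.single σ (1 : ℤ) • standardMonomial hn :
      multilinearPolys n).1 = MonoidAlgebra.single (multilinearWord hn σ) 1 := by
  rw [Submodule.coe_smul, Representation.asModuleEquiv_map_smul,
    Representation.asAlgebraHom_single_one]
  change renameVars n σ (MonoidAlgebra.single (multilinearWord hn 1) 1) = _
  rw [renameVars_single, map_multilinearWord, mul_one]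

theorem exists_smul_standardMonomial (p : multilinearPolys n) :
    ∃ f : IntSymGroupRing n, f • standardMonomial hn = p := by
  obtain ⟨p, hp⟩ := p
  have hp' : (permVars n).asModuleEquiv p ∈ multilinearSpan n := hp
  suffices h : ∀ q ∈ multilinearSpan n, ∃ f : IntSymGroupRing n,
      (permVars n).asModuleEquiv (f • standardMonomial hn : multilinearPolys n).1 = q by
    obtain ⟨f, hf⟩ := h _ hp'
    exact ⟨f, Subtype.ext ((permVars n).asModuleEquiv.injective hf)⟩
  intro q hq
  induction hq using Submodule.span_induction with
  | mem x hx =>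
    obtain ⟨σ, w, hw, rfl⟩ := hx
    exact ⟨MonoidAlgebra.single σ 1, by
      rw [single_smul_standardMonomial, eq_multilinearWord hn hw]⟩
  | zero => exact ⟨0, by rw [zero_smul, Submodule.coe_zero, map_zero]⟩
  | add x y _ _ hx hy =>
    obtain ⟨f, hf⟩ := hx
    obtain ⟨g, hg⟩ := hy
    exact ⟨f + g, by rw [add_smul, Submodule.coe_add, map_add, hf, hg]⟩
  | smul c x _ hx =>
    obtain ⟨f, hf⟩ := hx
    exact ⟨c • f, by rw [smul_assoc, ← hf]; rfl⟩

theorem apply_smul_standardMonomial {A : Type*} [Ring A] (ψ : FreeRngInt →ₙ+* A)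
    (f : IntSymGroupRing n) :
    ψ ((permVars n).asModuleEquiv (f • standardMonomial hn : multilinearPolys n).1) =
      evalWords (fun i => ψ (MonoidAlgebra.single (FreeSemigroup.of (i : ℕ)) 1)) f := by
  induction f using MonoidAlgebra.induction_linear with
  | zero => rw [zero_smul, Submodule.coe_zero, map_zero, map_zero, map_zero]
  | add f g hf hg => rw [add_smul, Submodule.coe_add, map_add, map_add, map_add, hf, hg]
  | single σ c =>
    rw [evalWords_single, show MonoidAlgebra.single σ c = c • MonoidAlgebra.single σ (1 : ℤ) by simp,
      smul_assoc]
    have : ((c • (MonoidAlgebra.single σ (1 : ℤ) • standardMonomial hn) : multilinearPolys n) :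
        FreeRngModule n) =
        c • ((MonoidAlgebra.single σ (1 : ℤ) • standardMonomial hn : multilinearPolys n) :
          FreeRngModule n) := rfl
    rw [this, map_zsmul, map_zsmul, single_smul_standardMonomial, map_single_word,
      head_cons_tail_multilinearWord, List.map_ofFn]
    rfl

variable (A : Type*) [Ring A]

/-- The surjection of `ℤ Sₙ` onto the multilinear polynomial functions. -/
noncomputable def toMultilinearFunctions :
    IntSymGroupRing n →ₗ[IntSymGroupRing n] MultilinearFunctions A n :=
  Submodule.mkQ _ ∘ₗ LinearMap.toSpanSingleton _ _ (standardMonomial hn)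

theorem toMultilinearFunctions_surjective :
    Function.Surjective (toMultilinearFunctions hn A) :=
  (Submodule.mkQ_surjective _).comp (exists_smul_standardMonomial hn)

/-- Homomorphisms from the free ring are arbitrary assignments of values to the variables, and only
the first `n` values matter. -/
theorem toMultilinearFunctions_eq_zero_iff (f : IntSymGroupRing n) :
    toMultilinearFunctions hn A f = 0 ↔ ∀ v : Fin n → A, evalWords v f = 0 := by
  rw [toMultilinearFunctions, LinearMap.comp_apply, Submodule.mkQ_apply,
    Submodule.Quotient.mk_eq_zero, Submodule.submoduleOf, Submodule.mem_comap, LinearMap.toSpanSingleton_apply]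
  have key : ((f • standardMonomial hn : multilinearPolys n) : FreeRngModule n) ∈
      identitiesModule A n ↔ ∀ ψ : FreeRngInt →ₙ+* A,
        ψ ((permVars n).asModuleEquiv (f • standardMonomial hn : multilinearPolys n).1) = 0 :=
    Iff.rfl
  refine key.trans ⟨fun h v => ?_, fun h ψ => ?_⟩
  · obtain ⟨ψ, hψ⟩ := exists_hom_of_values fun i => if hi : i < n then v ⟨i, hi⟩ else 0
    have := h ψ
    rw [apply_smul_standardMonomial] at this
    simpa [hψ] using this
  · rw [apply_smul_standardMonomial, h]

end MultilinearFunctions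

/-! ### Specht modules of hooks as boundaries in the exterior algebra -/

section Coordinates

variable {n : ℕ}

/-- The coordinate of degree `k` at the tuple `a`. -/
noncomputable def extCoord {k : ℕ} (a : Fin k → Fin n) : ExtAlg ℤ n →ₗ[ℤ] ℤ :=
  ExteriorAlgebra.liftAlternating
    (Pi.single k (Matrix.detRowAlternating.compLinearMap (LinearMap.funLeft ℤ ℤ a)))

theorem extCoord_extWord_ofFn {k : ℕ} (a w : Fin k → Fin n) :
    extCoord a (extWord ℤ (List.ofFn w)) =
      Matrix.det (Matrix.of fun i j => if w i = a j then (1 : ℤ) else 0) := by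
  rw [extWord_ofFn, extCoord, ExteriorAlgebra.liftAlternating_apply_ιMulti, Pi.single_eq_same]
  change Matrix.det _ = _
  congr 1
  ext i j
  simp [LinearMap.funLeft_apply, Pi.single_apply, eq_comm]

theorem extCoord_extBasis {k : ℕ} (J J' : Finset (Fin n)) (hJ : J.card = k) (hJ' : J'.card = k) :
    extCoord (J.orderEmbOfFin hJ) ((Pi.basisFun ℤ (Fin n)).ExteriorAlgebra J') =
      if J' = J then 1 else 0 := by
  rw [extBasis_apply, sort_eq_ofFn hJ', extCoord_extWord_ofFn]
  split_ifs with h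
  · subst h
    convert Matrix.det_one (R := ℤ) (n := Fin k)
    ext i j
    simp [Matrix.one_apply]
  · obtain ⟨x, hx, hx'⟩ : ∃ x ∈ J, x ∉ J' := by
      by_contra! hsub
      exact h (Finset.eq_of_subset_of_card_le hsub (by omega)).symm
    obtain ⟨j, rfl⟩ : x ∈ Set.range (J.orderEmbOfFin hJ) := by
      rwa [Finset.range_orderEmbOfFin]
    refine Matrix.det_eq_zero_of_column_eq_zero j fun i => ?_
    rw [Matrix.of_apply, if_neg]
    intro hij
    exact hx' (hij ▸ Finset.orderEmbOfFin_mem J' hJ' i)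

/-- The increasing tuples already give all basis coordinates in degree `k`. -/
theorem eq_zero_of_extCoord_eq_zero {k : ℕ} {y : ExtAlg ℤ n} (hy : extProj ℤ k y = y)
    (h : ∀ a : Fin k → Fin n, Function.Injective a → extCoord a y = 0) : y = 0 := by
  let B := (Pi.basisFun ℤ (Fin n)).ExteriorAlgebra
  have key : y = ∑ J, if J.card = k then B.repr y J • B J else 0 := by
    conv_lhs => rw [← hy, ← B.sum_repr y, map_sum]
    refine Finset.sum_congr rfl fun J _ => ?_
    rw [map_smul, extBasis_apply, extProj_extWord, Finset.length_sort]
    split_ifs <;> simp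
  rw [key]
  refine Finset.sum_eq_zero fun J _ => ?_
  split_ifs with hJ
  · have h1 := h _ (J.orderEmbOfFin hJ).injective
    rw [key, map_sum, Finset.sum_eq_single J] at h1
    · rw [if_pos hJ, map_smul, extCoord_extBasis _ _ hJ hJ, if_pos rfl, smul_eq_mul, mul_one] at h1
      rw [h1, zero_smul]
    · intro J' _ hne
      split_ifs with hJ'
      · rw [map_smul, extCoord_extBasis _ _ hJ hJ', if_neg hne, smul_zero]
      · rw [map_zero]
    · simp
  · rfl

theorem extContract_extWord_ofFn (k : ℕ) (c : Fin (k + 1) → Fin n) :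
    extContract ℤ (extWord ℤ (List.ofFn c)) =
      ∑ j : Fin (k + 1), ((-1) ^ (j : ℕ) : ℤ) • extWord ℤ (List.ofFn fun i => c (j.succAbove i)) := by
  induction k with
  | zero =>
    rw [List.ofFn_succ, extWord_cons, extContract_gen_mul]
    simp [extWord, extContract_one]
  | succ k ih =>
    rw [List.ofFn_succ, extWord_cons, extContract_gen_mul, ih, Finset.mul_sum, sub_eq_add_neg,
      ← Finset.sum_neg_distrib]
    conv_rhs => rw [Fin.sum_univ_succ]
    congr 1
    · simp
    · refine Finset.sum_congr rfl fun j _ => ?_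
      rw [List.ofFn_succ (f := fun i => c (j.succ.succAbove i)), extWord_cons, mul_smul_comm,
        Fin.val_succ, pow_succ, mul_neg_one, neg_smul]
      simp

theorem extCoord_extContract {k : ℕ} (a : Fin k → Fin n) (c : Fin (k + 1) → Fin n) :
    extCoord a (extContract ℤ (extWord ℤ (List.ofFn c))) =
      ∑ τ : Equiv.Perm (Fin (k + 1)), (Equiv.Perm.sign τ : ℤ) *
        if ∀ j : Fin k, c (τ j.succ) = a j then 1 else 0 := by
  -- The alternating sum for the contraction is the Laplace expansion along a column of ones.
  let N : Matrix (Fin (k + 1)) (Fin (k + 1)) ℤ :=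
    Matrix.of fun i => Fin.cons 1 fun j => if c i = a j then 1 else 0
  have h1 : extCoord a (extContract ℤ (extWord ℤ (List.ofFn c))) = N.det := by
    rw [Matrix.det_succ_column_zero, extContract_extWord_ofFn, map_sum]
    refine Finset.sum_congr rfl fun j _ => ?_
    rw [map_smul, extCoord_extWord_ofFn, smul_eq_mul]
    have : N j 0 = 1 := rfl
    rw [this, mul_one]
    rfl
  rw [h1, Matrix.det_apply']
  refine Finset.sum_congr rfl fun τ _ => ?_
  congr 1
  rw [Fin.prod_univ_succ]
  simp [N, Finset.prod_ite_zero]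

end Coordinates

section Cyclic

/-- Both cyclic modules are the quotient of `A` by the same annihilator. -/
theorem exists_injective_of_smul_eq_zero_iff {A V W : Type*} [Ring A] [AddCommGroup V]
    [AddCommGroup W] [Module A V] [Module A W] (u : V) (w : W)
    (h : ∀ x : A, x • u = 0 ↔ x • w = 0) :
    ∃ ζ : Submodule.span A {u} →ₗ[A] W, Function.Injective ζ ∧
      LinearMap.range ζ = Submodule.span A {w} := by
  have hk : LinearMap.ker (LinearMap.toSpanSingleton A V u) =
      LinearMap.ker (LinearMap.toSpanSingleton A W w) := by
    ext x
    simpa using h x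
  let e : Submodule.span A {u} ≃ₗ[A] Submodule.span A {w} :=
    (LinearEquiv.ofEq _ _ (LinearMap.range_toSpanSingleton u).symm) ≪≫ₗ
      (LinearMap.toSpanSingleton A V u).quotKerEquivRange.symm ≪≫ₗ
      Submodule.quotEquivOfEq _ _ hk ≪≫ₗ
      (LinearMap.toSpanSingleton A W w).quotKerEquivRange ≪≫ₗ
      LinearEquiv.ofEq _ _ (LinearMap.range_toSpanSingleton w)
  refine ⟨(Submodule.span A {w}).subtype ∘ₗ e.toLinearMap,
    (Submodule.injective_subtype _).comp e.injective, ?_⟩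
  rw [LinearMap.range_comp, LinearEquiv.range, Submodule.map_top, Submodule.range_subtype]

end Cyclic

/-! ### Hook tableaux and the comparison of annihilators -/

section Hooks

variable {n : ℕ} {k : Fin n} (T : YoungTableau n (hookDiagram n k))

/-- The entries of the first column of a tableau of hook shape. -/
def hookColumn (j : Fin (k + 1)) : Fin n :=
  T.symm ⟨(j, 0), (mem_hookDiagram n k _).2 (by
    have := k.2
    have := j.2
    change ((j : ℕ) = 0 ∧ 0 < n - k) ∨ (1 ≤ (j : ℕ) ∧ (j : ℕ) ≤ k ∧ 0 = 0)
    omega)⟩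

theorem tableau_hookColumn (j : Fin (k + 1)) : (T (hookColumn T j)).1 = ((j : ℕ), 0) := by
  simp [hookColumn]

theorem hookColumn_injective : Function.Injective (hookColumn T) := fun i j hij => by
  have := congrArg (fun x => (T x).1.1) hij
  simp only [tableau_hookColumn] at this
  exact Fin.ext this

theorem tableau_ext {i j : Fin n} (h1 : (T i).1.1 = (T j).1.1) (h2 : (T i).1.2 = (T j).1.2) :
    i = j :=
  T.injective (Subtype.ext (Prod.ext h1 h2))

theorem exists_hookColumn_eq_of_col {i : Fin n} (hi : (T i).1.2 = 0) :
    ∃ j, hookColumn T j = i := by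
  have h := (mem_hookDiagram n k _).1 (T i).2
  refine ⟨⟨(T i).1.1, by omega⟩, tableau_ext T ?_ ?_⟩
  · rw [tableau_hookColumn]
  · rw [tableau_hookColumn, hi]

theorem exists_hookColumn_succ_eq_of_row {i : Fin n} (hi : (T i).1.1 ≠ 0) :
    ∃ j : Fin k, hookColumn T j.succ = i := by
  have h := (mem_hookDiagram n k _).1 (T i).2
  obtain ⟨j, rfl⟩ := exists_hookColumn_eq_of_col T (i := i) (by omega)
  rw [tableau_hookColumn] at hi
  obtain ⟨j', rfl⟩ := Fin.exists_succ_eq.2 (show j ≠ 0 by rintro rfl; simp at hi)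
  exact ⟨j', rfl⟩

/-- All rows below the first are single boxes, so stabilising rows means fixing the first column
except its corner. -/
theorem mem_rowStabilizer_iff {ρ : Equiv.Perm (Fin n)} :
    ρ ∈ rowStabilizer T ↔ ∀ j : Fin k, ρ (hookColumn T j.succ) = hookColumn T j.succ := by
  constructor
  · intro h j
    have h1 : (T (ρ (hookColumn T j.succ))).1.1 = _ := h _
    have h2 := (mem_hookDiagram n k _).1 (T (ρ (hookColumn T j.succ))).2
    rw [tableau_hookColumn] at h1
    refine tableau_ext T (by rw [h1, tableau_hookColumn]) ?_
    rw [tableau_hookColumn]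
    simp only [Fin.val_succ] at h1
    omega
  · intro h i
    by_cases hi : (T i).1.1 = 0
    · rw [hi]
      by_contra hne
      obtain ⟨j, hj⟩ := exists_hookColumn_succ_eq_of_row T hne
      rw [← h j] at hj
      rw [← ρ.injective hj, tableau_hookColumn] at hi
      simp at hi
    · obtain ⟨j, rfl⟩ := exists_hookColumn_succ_eq_of_row T hi
      rw [h]

theorem apply_eq_self_of_mem_colStabilizer {σ : Equiv.Perm (Fin n)} (hσ : σ ∈ colStabilizer T)
    {i : Fin n} (hi : i ∉ Set.range (hookColumn T)) : σ i = i := by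
  have h0 : (T i).1.2 ≠ 0 := fun h => hi (exists_hookColumn_eq_of_col T h)
  have h1 : (T (σ i)).1.2 = (T i).1.2 := hσ i
  have h2 := (mem_hookDiagram n k _).1 (T i).2
  have h3 := (mem_hookDiagram n k _).1 (T (σ i)).2
  exact tableau_ext T (by omega) h1

/-- Permutations of the first column as permutations of the whole tableau. -/
def columnPerm (τ : Equiv.Perm (Fin (k + 1))) : Equiv.Perm (Fin n) :=
  τ.viaFintypeEmbedding ⟨hookColumn T, hookColumn_injective T⟩

theorem columnPerm_hookColumn (τ : Equiv.Perm (Fin (k + 1))) (j : Fin (k + 1)) :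
    columnPerm T τ (hookColumn T j) = hookColumn T (τ j) :=
  Equiv.Perm.viaFintypeEmbedding_apply_image τ ⟨hookColumn T, hookColumn_injective T⟩ j

theorem columnPerm_of_notMem (τ : Equiv.Perm (Fin (k + 1))) {i : Fin n}
    (hi : i ∉ Set.range (hookColumn T)) : columnPerm T τ i = i :=
  Equiv.Perm.viaFintypeEmbedding_apply_notMem_range τ
    ⟨hookColumn T, hookColumn_injective T⟩ hi

theorem sign_columnPerm (τ : Equiv.Perm (Fin (k + 1))) :
    Equiv.Perm.sign (columnPerm T τ) = Equiv.Perm.sign τ :=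
  Equiv.Perm.viaFintypeEmbedding_sign τ _

theorem columnPerm_mem (τ : Equiv.Perm (Fin (k + 1))) : columnPerm T τ ∈ colStabilizer T := by
  intro i
  by_cases hi : i ∈ Set.range (hookColumn T)
  · obtain ⟨j, rfl⟩ := hi
    rw [columnPerm_hookColumn, tableau_hookColumn, tableau_hookColumn]
  · rw [columnPerm_of_notMem T τ hi]

theorem columnPerm_injective : Function.Injective (columnPerm T) := fun τ τ' h => by
  ext j : 1
  refine hookColumn_injective T ?_
  rw [← columnPerm_hookColumn, h, columnPerm_hookColumn]

theorem exists_columnPerm_eq {σ : Equiv.Perm (Fin n)} (hσ : σ ∈ colStabilizer T) :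
    ∃ τ, columnPerm T τ = σ := by
  have h : ∀ j, ∃ j', hookColumn T j' = σ (hookColumn T j) := fun j =>
    exists_hookColumn_eq_of_col T ((hσ _).trans (by rw [tableau_hookColumn]))
  choose f hf using h
  have hinj : Function.Injective f := fun i j hij => by
    have := hf i
    rw [hij, hf j] at this
    exact (hookColumn_injective T (σ.injective this)).symm
  refine ⟨Equiv.ofBijective f (Finite.injective_iff_bijective.1 hinj), ?_⟩
  ext i : 1
  by_cases hi : i ∈ Set.range (hookColumn T)
  · obtain ⟨j, rfl⟩ := hi
    rw [columnPerm_hookColumn, Equiv.ofBijective_apply, hf]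
  · rw [columnPerm_of_notMem T _ hi, apply_eq_self_of_mem_colStabilizer T hσ hi]

/-- The contraction of the wedge of the first column. -/
noncomputable def columnBoundary : ExtModule n :=
  (extRep n).asModuleEquiv.symm (extContract ℤ (extWord ℤ (List.ofFn (hookColumn T))))

theorem single_smul_columnBoundary (g : Equiv.Perm (Fin n)) :
    (extRep n).asModuleEquiv (MonoidAlgebra.single g (1 : ℤ) • columnBoundary T) =
      extContract ℤ (extWord ℤ (List.ofFn fun j => g (hookColumn T j))) := by
  rw [asModuleEquiv_single_one_smul, columnBoundary, LinearEquiv.apply_symm_apply,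
    ← extContract_extRep, extRep_extWord, List.map_ofFn]
  rfl

/-- A coset of the row stabilizer is determined by the images of the column entries below the
corner. -/
theorem coeff_mul_rowSymmetrizer (h π : Equiv.Perm (Fin n)) (c : ℤ) :
    (MonoidAlgebra.single h c * rowSymmetrizer T).coeff π =
      if ∀ j : Fin k, h (hookColumn T j.succ) = π (hookColumn T j.succ) then c else 0 := by
  classical
  have e : (∀ j : Fin k, h (hookColumn T j.succ) = π (hookColumn T j.succ)) ↔
      h⁻¹ * π ∈ rowStabilizer T := by
    rw [mem_rowStabilizer_iff]
    refine forall_congr' fun j => ?_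
    rw [Equiv.Perm.mul_apply, Equiv.Perm.inv_eq_iff_eq, eq_comm]
  rw [rowSymmetrizer, Finset.mul_sum, MonoidAlgebra.coeff_sum, Finsupp.finsetSum_apply]
  simp only [MonoidAlgebra.single_mul_single, mul_one, MonoidAlgebra.coeff_single,
    Finsupp.single_apply, e, ← eq_inv_mul_iff_mul_eq]
  rw [Finset.sum_ite_eq']
  simp

/-- Both sides are the same signed sum over permutations of the first column: on the left from the
column antisymmetrizer, on the right from the determinant with a column of ones. -/
theorem coeff_mul_colAntisymmetrizer_mul_rowSymmetrizer (x : IntSymGroupRing n)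
    (π : Equiv.Perm (Fin n)) :
    (x * (colAntisymmetrizer T * rowSymmetrizer T)).coeff π =
      extCoord (fun j : Fin k => π (hookColumn T j.succ))
        ((extRep n).asModuleEquiv (x • columnBoundary T)) := by
  classical
  induction x using MonoidAlgebra.induction_linear with
  | zero => simp
  | add x y hx hy => rw [add_mul, add_smul, map_add, map_add, ← hx, ← hy]; rfl
  | single g c =>
    rw [show MonoidAlgebra.single g c = c • MonoidAlgebra.single g (1 : ℤ) by simp, smul_assoc,
      map_zsmul, map_zsmul, smul_mul_assoc, single_smul_columnBoundary, extCoord_extContract]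
    rw [MonoidAlgebra.coeff_smul, Finsupp.smul_apply]
    congr 1
    rw [colAntisymmetrizer, Finset.sum_mul, Finset.mul_sum, MonoidAlgebra.coeff_sum,
      Finsupp.finsetSum_apply]
    symm
    refine Finset.sum_nbij (columnPerm T) (fun τ _ => ?_) (columnPerm_injective T).injOn
      (fun σ hσ => ?_) fun τ _ => ?_
    · simpa using columnPerm_mem T τ
    · obtain ⟨τ, rfl⟩ := exists_columnPerm_eq T (by simpa using hσ)
      exact ⟨τ, by simp, rfl⟩
    · rw [← mul_assoc, MonoidAlgebra.single_mul_single, one_mul, coeff_mul_rowSymmetrizer,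
        sign_columnPerm]
      simp [columnPerm_hookColumn]

theorem exists_perm_comp_eq {m : ℕ} {a b : Fin m → Fin n} (ha : Function.Injective a)
    (hb : Function.Injective b) : ∃ π : Equiv.Perm (Fin n), ∀ j, π (a j) = b j := by
  have := Equiv.Perm.isMultiplyPretransitive (Fin n) m
  obtain ⟨π, hπ⟩ := MulAction.exists_smul_eq (Equiv.Perm (Fin n)) (⟨a, ha⟩ : Fin m ↪ Fin n) ⟨b, hb⟩
  exact ⟨π, fun j => DFunLike.congr_fun hπ j⟩

/-- Every injective `k`-tuple is the image of the column below the corner under some permutation, so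
the group ring coefficients give all coordinates needed. -/
theorem smul_symmetrizer_eq_zero_iff (x : IntSymGroupRing n) :
    x • (colAntisymmetrizer T * rowSymmetrizer T) = 0 ↔ x • columnBoundary T = 0 := by
  rw [smul_eq_mul]
  constructor
  · intro h
    refine (extRep n).asModuleEquiv.injective ?_
    rw [map_zero]
    refine eq_zero_of_extCoord_eq_zero (k := k) ?_ fun a ha => ?_
    · have h1 : extProjHom (k : ℕ) (columnBoundary T) = columnBoundary T := by
        refine (extRep n).asModuleEquiv.injective ?_
        refine (asModuleEquiv_extEquivariant _ _ _).trans ?_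
        rw [columnBoundary, LinearEquiv.apply_symm_apply]
        exact extProj_of_mem ℤ (extContract_extWord_mem ℤ _ _ (by simp))
      have h2 := congrArg (extRep n).asModuleEquiv ((extProjHom (k : ℕ)).map_smul x
        (columnBoundary T))
      rw [h1] at h2
      exact (asModuleEquiv_extEquivariant _ _ _).symm.trans h2
    · obtain ⟨π, hπ⟩ := exists_perm_comp_eq
        ((hookColumn_injective T).comp (Fin.succ_injective _)) ha
      obtain rfl : (fun j : Fin k => π (hookColumn T j.succ)) = a := funext hπ
      rw [← coeff_mul_colAntisymmetrizer_mul_rowSymmetrizer, h]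
      rfl
  · intro h
    ext π
    rw [coeff_mul_colAntisymmetrizer_mul_rowSymmetrizer, h, map_zero, map_zero]
    rfl

/-- Some permutation carries the first column to any increasing `(k + 1)`-tuple, so one boundary
generates. -/
theorem extBoundaries_eq_span : extBoundaries n k =
    Submodule.span (IntSymGroupRing n) {columnBoundary T} := by
  apply le_antisymm
  · intro z hz
    obtain ⟨y, hy⟩ := mem_extBoundaries.1 hz
    obtain rfl : (extRep n).asModuleEquiv.symm (extContract ℤ (extProj ℤ (k + 1) y)) = z :=
      (extRep n).asModuleEquiv.injective (by rw [LinearEquiv.apply_symm_apply, hy])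
    clear hz hy
    induction (Pi.basisFun ℤ (Fin n)).ExteriorAlgebra.mem_span y using
      Submodule.span_induction with
    | mem x hx =>
      obtain ⟨J, rfl⟩ := hx
      rw [extBasis_apply, extProj_extWord]
      split_ifs with hJ
      · have hJ' : J.card = k + 1 := by simpa using hJ
        obtain ⟨π, hπ⟩ := exists_perm_comp_eq (hookColumn_injective T)
          (J.orderEmbOfFin hJ').injective
        refine Submodule.mem_span_singleton.2 ⟨MonoidAlgebra.single π 1, ?_⟩
        refine (extRep n).asModuleEquiv.injective ?_
        rw [single_smul_columnBoundary, LinearEquiv.apply_symm_apply,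
          sort_eq_ofFn hJ']
        simp only [hπ]
      · rw [map_zero, map_zero]
        exact zero_mem _
    | zero => rw [map_zero, map_zero, map_zero]; exact zero_mem _
    | add x y _ _ hx hy => rw [map_add, map_add, map_add]; exact add_mem hx hy
    | smul c x _ hx =>
      rw [← Int.cast_smul_eq_zsmul ℤ, Int.cast_id, map_zsmul, map_zsmul, map_zsmul]
      exact zsmul_mem hx c
  · rw [Submodule.span_singleton_le_iff_mem, mem_extBoundaries]
    refine ⟨extWord ℤ (List.ofFn (hookColumn T)), ?_⟩
    rw [extProj_extWord, if_pos (by simp), columnBoundary, LinearEquiv.apply_symm_apply]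

/-- The Specht module of a hook is isomorphic to the module of boundaries. -/
theorem exists_specht_embedding : ∃ ζ : spechtModule T →ₗ[IntSymGroupRing n] ExtModule n,
    Function.Injective ζ ∧ LinearMap.range ζ = extBoundaries n k := by
  rw [extBoundaries_eq_span T]
  exact exists_injective_of_smul_eq_zero_iff _ _ (smul_symmetrizer_eq_zero_iff T)

end Hooks

/-! ### Reduction modulo `ℓ` and the chain -/

section MainTheorem

/-- The factors of the image of the hook filtration are the reduced hook Specht modules. -/
theorem nonempty_quotient_equiv {R : Type*} [CommRing R] (l : ℕ) [CharP R l]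
    (hl : Odd l ∨ l = 0) {n : ℕ} (hn : 1 ≤ n) (k : Fin n) (T : YoungTableau n (hookDiagram n k)) :
    Nonempty ((↥((hookFiltration n k).map (toMultilinearFunctions hn (GrassmannAlgebra R))) ⧸
      ((hookFiltration n (k + 1)).map
        (toMultilinearFunctions hn (GrassmannAlgebra R))).submoduleOf
        ((hookFiltration n k).map (toMultilinearFunctions hn (GrassmannAlgebra R))))
        ≃ₗ[IntSymGroupRing n]
      (↥(spechtModule T) ⧸ multiplesSubmodule (IntSymGroupRing n) ↥(spechtModule T) l)) := by
  obtain ⟨ζ, hζ, hr⟩ := exists_specht_embedding T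
  set π := toMultilinearFunctions hn (GrassmannAlgebra R)
  set H := hookFiltration n k
  let m := ((k : ℕ) + 1) / 2
  -- On `H` the image of `hookMap k` is exactly `2^m` times the boundaries, that is, the range of
  -- `ζ'`. Inverting `ζ'` yields the surjection `t` of `H` onto the Specht module.
  let ζ' : spechtModule T →ₗ[IntSymGroupRing n] ExtModule n := (2 ^ m : ℕ) • ζ
  have hζ' : ∀ s, ζ' s = (2 ^ m : ℤ) • ζ s := fun s => by
    change (2 ^ m : ℕ) • ζ s = _
    rw [← natCast_zsmul]
    norm_num
  have hinj : Function.Injective ζ' := by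
    refine (injective_iff_map_eq_zero ζ').2 fun s hs => ?_
    rw [hζ'] at hs
    exact (injective_iff_map_eq_zero ζ).1 hζ s (extModule_zsmul_eq_zero (by positivity) hs)
  have hmem : ∀ f : H, (hookMap (k : ℕ)).domRestrict H f ∈ LinearMap.range ζ' := fun f => by
    obtain ⟨z, hz, hfz⟩ := hookMap_eq_two_pow_smul hn f.2
    rw [← hr] at hz
    obtain ⟨s, rfl⟩ := hz
    exact ⟨s, (hζ' s).trans hfz.symm⟩
  let t : H →ₗ[IntSymGroupRing n] spechtModule T :=
    (LinearEquiv.ofInjective ζ' hinj).symm.toLinearMap ∘ₗ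
      ((hookMap (k : ℕ)).domRestrict H).codRestrict _ hmem
  have ht : ∀ f : H, ζ' (t f) = hookMap (k : ℕ) (f : IntSymGroupRing n) := fun f =>
    congrArg Subtype.val ((LinearEquiv.ofInjective ζ' hinj).apply_symm_apply ⟨_, hmem f⟩)
  have hts : Function.Surjective t := fun s => by
    obtain ⟨f, hf, hfs⟩ := exists_hookMap_eq_two_pow_smul (n := n) (k := k) (z := ζ s)
      (hr ▸ LinearMap.mem_range_self ζ s)
    refine ⟨⟨f, hf⟩, hinj ?_⟩
    rw [ht, hζ']
    exact hfs
  let p := Submodule.mkQ (((hookFiltration n (k + 1)).map π).submoduleOf (H.map π)) ∘ₗ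
    π.submoduleMap H
  have hp : Function.Surjective p :=
    (Submodule.mkQ_surjective _).comp (LinearMap.submoduleMap_surjective π H)
  let q := (multiplesSubmodule (IntSymGroupRing n) (spechtModule T) l).mkQ ∘ₗ t
  have hq : Function.Surjective q := (Submodule.mkQ_surjective _).comp hts
  have hπ : ∀ f, π f = 0 ↔ ∃ h ∈ hookFiltration n n, ∃ y, f = h + l • y := fun f =>
    (toMultilinearFunctions_eq_zero_iff hn (GrassmannAlgebra R) f).trans
      (forall_evalWords_eq_zero_iff hl hn f)
  -- Both quotients are quotients of `H`, so it suffices that the kernels agree.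
  have hker : LinearMap.ker p = LinearMap.ker q := by
    ext f
    have hp' : f ∈ LinearMap.ker p ↔ ∃ h ∈ hookFiltration n (k + 1), π h = π f := by
      rw [LinearMap.mem_ker, LinearMap.comp_apply, Submodule.mkQ_apply,
        Submodule.Quotient.mk_eq_zero]
      rfl
    have hq' : f ∈ LinearMap.ker q ↔ ∃ s : spechtModule T, l • s = t f := by
      rw [LinearMap.mem_ker, LinearMap.comp_apply, Submodule.mkQ_apply,
        Submodule.Quotient.mk_eq_zero]
      rfl
    rw [hp', hq']
    constructor
    · rintro ⟨h, hh, hhf⟩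
      have h0 : π (f - h) = 0 := by rw [map_sub, hhf, sub_self]
      obtain ⟨h', hh', y, hy⟩ := (hπ _).1 h0
      have hh1 := mem_hookFiltration_succ.1 hh
      have hh2 := mem_hookFiltration_succ.1 (hookFiltration_antitone (show (k : ℕ) + 1 ≤ n from k.2) hh')
      rcases eq_or_ne l 0 with rfl | hl0
      · refine ⟨0, hinj ?_⟩
        rw [smul_zero, map_zero, ht]
        rw [zero_smul, add_zero] at hy
        rw [sub_eq_iff_eq_add.1 hy, map_add, hh1.2, hh2.2, add_zero]
      · have hly : l • y = f - h - h' := by rw [hy]; abel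
        -- The target of the hook maps is torsion-free, so `l • y ∈ H` forces `y ∈ H` for `l ≠ 0`.
        -- This is why `l = 0` is treated apart.
        have hyH : y ∈ H := by
          refine mem_hookFiltration.2 fun j hj => ?_
          have h1 : l • y ∈ H := by
            rw [hly]
            exact sub_mem (sub_mem f.2 hh1.1) hh2.1
          have h2 := mem_hookFiltration.1 h1 j hj
          rw [map_nsmul, ← natCast_zsmul] at h2
          exact extModule_zsmul_eq_zero (by exact_mod_cast hl0) h2
        refine ⟨t ⟨y, hyH⟩, hinj ?_⟩
        rw [map_nsmul, ht, ht, ← map_nsmul, hly, map_sub, map_sub, hh1.2, hh2.2, sub_zero, sub_zero]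
    · rintro ⟨s, hs⟩
      obtain ⟨y, rfl⟩ := hts s
      refine ⟨f - l • y, mem_hookFiltration_succ.2 ⟨(f - l • y).2, ?_⟩, ?_⟩
      · have h1 := ht (f - l • y)
        rw [map_sub, map_nsmul, hs, sub_self, map_zero] at h1
        exact h1.symm
      · have h1 : π (l • (y : IntSymGroupRing n)) = 0 :=
          (hπ _).2 ⟨0, zero_mem _, y, (zero_add _).symm⟩
        rw [map_sub, h1, sub_zero]
  exact ⟨(LinearMap.quotKerEquivOfSurjective p hp).symm ≪≫ₗ Submodule.quotEquivOfEq _ _ hker ≪≫ₗ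
    LinearMap.quotKerEquivOfSurjective q hq⟩

theorem mainTheorem9 {R : Type*} [CommRing R] (l : ℕ) [CharP R l] (hl : Odd l ∨ l = 0)
    (n : ℕ) (hn : 1 ≤ n) :
    ∃ (M : Fin (n + 1) → Submodule (IntSymGroupRing n) (MultilinearFunctions (GrassmannAlgebra R) n))
      (e : Equiv.Perm (Fin n)),
      Monotone M ∧ M 0 = ⊥ ∧ M (Fin.last n) = ⊤ ∧
      ∀ (i : Fin n) (T : YoungTableau n (hookDiagram n (e i))),
        Nonempty ((↥(M i.succ) ⧸ (M i.castSucc).submoduleOf (M i.succ)) ≃ₗ[IntSymGroupRing n]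
          (↥(spechtModule T) ⧸ multiplesSubmodule (IntSymGroupRing n) ↥(spechtModule T) l)) := by
  -- The hook filtration decreases, so it is read backwards: the `i`-th factor, counted from 0,
  -- belongs to `k = n - 1 - i`.
  refine ⟨fun i => (hookFiltration n (n - i)).map
    (toMultilinearFunctions hn (GrassmannAlgebra R)), Fin.revPerm, ?_, ?_, ?_, ?_⟩
  · intro i j hij
    exact Submodule.map_mono (hookFiltration_antitone (Nat.sub_le_sub_left hij n))
  · refine (Submodule.eq_bot_iff _).2 ?_
    rintro _ ⟨f, hf, rfl⟩
    refine (toMultilinearFunctions_eq_zero_iff hn _ f).2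
      ((forall_evalWords_eq_zero_iff hl hn f).2 ⟨f, hf, 0, ?_⟩)
    rw [smul_zero, add_zero]
  · have h0 : hookFiltration n 0 = ⊤ := by
      refine eq_top_iff.2 fun f _ => mem_hookFiltration.2 fun j hj => ?_
      omega
    simp only [Fin.val_last, Nat.sub_self, h0, Submodule.map_top]
    exact LinearMap.range_eq_top.2 (toMultilinearFunctions_surjective hn _)
  · intro i T
    have h1 : n - (i.succ : ℕ) = (Fin.revPerm i : Fin n) := by simp [Fin.val_rev]
    have h2 : n - (i.castSucc : ℕ) = (Fin.revPerm i : Fin n) + 1 := by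
      have := i.2
      simp [Fin.val_rev]
      omega
    beta_reduce
    rw [h1, h2]
    exact nonempty_quotient_equiv (R := R) l hl hn (Fin.revPerm i) T

end MainTheorem
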